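/- Let $\sigma_1=\begin{pmatrix}0&1\\1&0\end{pmatrix}$, $\sigma_2=\begin{pmatrix}0&-i\\i&0\end{pmatrix}$, $\sigma_3=\begin{pmatrix}1&0\\0&-1\end{pmatrix}$ be the Pauli matrices and $\alpha_j=\begin{pmatrix}0&\sigma_j\\\sigma_j&0\end{pmatrix}$ ($j=1,2,3$) the $4\times4$ Dirac matrices. Let $Q=(q_{jk})$ be a function on $\mathbb R^3$ whose values $Q(x)$ are $4\times4$ Hermitian matrices, with measurable entries such that, for some constants $\rho>1$ and $C>0$, $|q_{jk}(x)|\le C(1+|x|^2)^{-\rho/2}$ for all $x\in\mathbb R^3$ and all $j,k$. Let $H=\sum_{j=1}^3\alpha_j\frac1i\partial_j+Q$ be the massless Dirac operator in $[L^2(\mathbb R^3)]^4$ with domain the Sobolev space $[H^1(\mathbb R^3)]^4$. Let $f$ be a zero mode of $H$, that is, $f\in[H^1(\mathbb R^3)]^4$ and $Hf=0$. Then $Qf$ is integrable on $\mathbb R^3$, and $f$ has a (unique) continuous representative, again denoted by $f$, for which the following holds, $|\cdot|$ being the Euclidean norm on $\mathbb C^4$ on both sides. For every $\omega$ in the unit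 sphere $\mathbb S^2$, $$\lim_{r\to+\infty}r^2|f(r\omega)|=\frac1{4\pi}\Big|\int_{\mathbb R^3}Q(y)f(y)\,dy\Big| ;$$ in particular the limit does not depend on $\omega$. Moreover, the following three conditions are equivalent: (a) $\lim_{r\to+\infty}r^2f(r\omega)=0$ for some $\omega\in\mathbb S^2$; (b) $\lim_{r\to+\infty}r^2f(r\omega)=0$ for every $\omega\in\mathbb S^2$; (c) $\int_{\mathbb R^3}Q(y)f(y)\,dy=0$. -/

import Mathlib

open MeasureTheory Filter Topology

namespace DiracZeroMode

open scoped ContDiff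

/-- Euclidean three-space. -/
abbrev R3 : Type := EuclideanSpace ℝ (Fin 3)

/-- Four-component spinors, with the Hermitian norm of `ℂ⁴`. -/
abbrev Spinor : Type := EuclideanSpace ℂ (Fin 4)

/-- The Pauli matrices `σ₁, σ₂, σ₃`. -/
def pauli : Fin 3 → Matrix (Fin 2) (Fin 2) ℂ :=
  ![!![0, 1; 1, 0], !![0, -Complex.I; Complex.I, 0], !![1, 0; 0, -1]]

/-- The Dirac matrices `α₁, α₂, α₃`: two-by-two blocks with zero diagonal blocks and
off-diagonal blocks `σⱼ`. -/
def alpha (j : Fin 3) : Matrix (Fin 4) (Fin 4) ℂ :=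
  Matrix.reindex finSumFinEquiv finSumFinEquiv (Matrix.fromBlocks 0 (pauli j) (pauli j) 0)

/-- A matrix-valued potential whose entries are Lebesgue measurable and bounded by
`C ⟨x⟩ ^ (-ρ)` with `ρ > 1`, `⟨x⟩ = √(1 + |x|²)`, and whose values are Hermitian. -/
structure IsAdmissiblePotential (Q : R3 → Matrix (Fin 4) (Fin 4) ℂ) : Prop where
  aemeasurable : ∀ j k, AEMeasurable (fun x => Q x j k) volume
  decay : ∃ ρ C : ℝ, 1 < ρ ∧ 0 < C ∧
    ∀ x j k, ‖Q x j k‖ ≤ C * (Real.sqrt (1 + ‖x‖ ^ 2)) ^ (-ρ)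
  hermitian : ∀ x, (Q x).IsHermitian

/-- `g` is the weak partial derivative `∂ⱼ f` on all of `ℝ³`, for functions that are integrable
on compact sets. -/
def HasWeakPartialDeriv (j : Fin 3) (f g : R3 → Spinor) : Prop :=
  ∀ φ : R3 → ℝ, ContDiff ℝ ∞ φ → HasCompactSupport φ →
    ∫ x, (fderiv ℝ φ x (EuclideanSpace.single j 1)) • f x = -∫ x, φ x • g x

/-- `f` belongs to the Sobolev space `[H¹(ℝ³)]⁴`, with weak gradient `df`. -/
structure IsSobolevOneWithGradient (f : R3 → Spinor) (df : Fin 3 → R3 → Spinor) : Prop where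
  memLp : MemLp f 2 volume
  memLp_grad : ∀ j, MemLp (df j) 2 volume
  weakDeriv : ∀ j, HasWeakPartialDeriv j f (df j)

/-- The pointwise expression `(α · D) f + Q f`, with `D = (1 / i) ∇` and `df` for `∇ f`. -/
noncomputable def diracExpr (Q : R3 → Matrix (Fin 4) (Fin 4) ℂ) (f : R3 → Spinor)
    (df : Fin 3 → R3 → Spinor) (x : R3) : Spinor :=
  (∑ j, Matrix.toEuclideanLin (alpha j) (Complex.I⁻¹ • df j x)) +
    Matrix.toEuclideanLin (Q x) (f x)

/-- The graph of the Dirac operator `H = α · D + Q` with domain `[H¹(ℝ³)]⁴`: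
`f` is in the domain and `H f = h` almost everywhere. -/
def DiracGraph (Q : R3 → Matrix (Fin 4) (Fin 4) ℂ) (f h : R3 → Spinor) : Prop :=
  ∃ df : Fin 3 → R3 → Spinor, IsSobolevOneWithGradient f df ∧ diracExpr Q f df =ᵐ[volume] h

/-- A zero mode: an element `f` of the domain of `H` such that `H f = 0`. -/
def IsZeroMode (Q : R3 → Matrix (Fin 4) (Fin 4) ℂ) (f : R3 → Spinor) : Prop :=
  DiracGraph Q f 0

/-- The function `Q f`. -/
noncomputable def potentialMul (Q : R3 → Matrix (Fin 4) (Fin 4) ℂ) (f : R3 → Spinor) (y : R3) :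
    Spinor :=
  Matrix.toEuclideanLin (Q y) (f y)

end DiracZeroMode

/-!
Write `c v = (1 / i) α · v`, so that `c v * c v = -‖v‖ ^ 2` and `f` solves `D f + Q f = 0` with
`D = ∑ j, c (e j) ∂ⱼ`. In dimension `n` the kernel `‖z‖ ^ (-n) c z` is a fundamental solution of `D`
up to a constant. Testing the equation with smooth truncations of this kernel to the shells
`r ≤ ‖y - x‖ ≤ 1 / r` and letting `r → 0` gives, at Lebesgue points of `f`, the representation
`|S ^ (n - 1)| f x = ∫ ‖x - y‖ ^ (-n) c (x - y) (Q f y) dy`; the outer boundary term vanishes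
because `f` is square integrable.

Hence `u = |f|` satisfies `u ≤ C I u` for the Riesz type operator `I` with kernel
`‖x - y‖ ^ (1 - n) (1 + ‖y‖) ^ (-ρ)`. Its kernel is the cube of `k = ‖x - y‖ ^ ((1 - n) / 3)` with
respect to a weighted measure, and for `n ≤ 3` the power `k ^ 4` is still uniformly integrable, so
that two applications of the Cauchy–Schwarz inequality bound `u`. Each further application of `I`
improves the decay of `u` by up to `ρ - 1`, until `u = O(‖x‖ ^ (1 - n))`. Then
`Q f = O(‖x‖ ^ (1 - n - ρ))` is integrable, the representation defines a continuous function, and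
in `r ^ (n - 1) f (r ω)` the kernel tends to `c ω`. So the limit is `c ω (∫ Q f) / |S ^ (n - 1)|`,
and `c ω` is isometric.
-/

namespace DiracZeroMode

open scoped ENNReal NNReal Gradient
open Module (finrank)

section Kernels

variable {α : Type*} [MeasurableSpace α] {μ ν : Measure α}

lemma sq_lintegral_mul_le {f g : α → ℝ≥0∞} (hf : AEMeasurable f μ) (hg : AEMeasurable g μ) :
    (∫⁻ a, f a * g a ∂μ) ^ 2 ≤ (∫⁻ a, f a ^ 2 ∂μ) * ∫⁻ a, g a ^ 2 ∂μ := by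
  have h := ENNReal.lintegral_mul_le_Lp_mul_Lq μ Real.HolderConjugate.two_two hf hg
  simp only [Pi.mul_apply, ENNReal.rpow_two] at h
  calc _ ≤ ((∫⁻ a, f a ^ 2 ∂μ) ^ (1 / 2 : ℝ) * (∫⁻ a, g a ^ 2 ∂μ) ^ (1 / 2 : ℝ)) ^ 2 := by gcongr
    _ = _ := by
      rw [mul_pow, ← ENNReal.rpow_natCast, ← ENNReal.rpow_natCast, ← ENNReal.rpow_mul,
        ← ENNReal.rpow_mul]
      norm_num

lemma sq_lintegral_pow_three_mul_le {k u : α → ℝ≥0∞} (hk : Measurable k) (hu : AEMeasurable u μ) :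
    (∫⁻ y, k y ^ 3 * u y ∂μ) ^ 2 ≤ (∫⁻ y, k y ^ 4 ∂μ) * ∫⁻ y, k y ^ 2 * u y ^ 2 ∂μ := by
  calc (∫⁻ y, k y ^ 3 * u y ∂μ) ^ 2 = (∫⁻ y, k y ^ 2 * (k y * u y) ∂μ) ^ 2 := by
        congr 2 with y; ring
    _ ≤ (∫⁻ y, (k y ^ 2) ^ 2 ∂μ) * ∫⁻ y, (k y * u y) ^ 2 ∂μ :=
        sq_lintegral_mul_le (hk.pow_const 2).aemeasurable (hk.aemeasurable.mul hu)
    _ = _ := by simp only [← pow_mul, mul_pow, Nat.reduceMul]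

variable {k : α → α → ℝ≥0∞} {u : α → ℝ≥0∞}

lemma ae_lintegral_pow_three_mul_lt_top [SFinite μ] [SFinite ν] (hk : Measurable k.uncurry)
    (hu : AEMeasurable u μ) (hu2 : ∫⁻ y, u y ^ 2 ∂μ < ∞) {M N : ℝ≥0}
    (hM : ∀ x, ∫⁻ y, k x y ^ 4 ∂μ ≤ M) (hN : ∀ y, ∫⁻ x, k x y ^ 2 ∂ν ≤ N) :
    ∀ᵐ x ∂ν, ∫⁻ y, k x y ^ 3 * u y ∂μ < ∞ := by
  have hmeas : AEMeasurable (fun p : α × α => k p.1 p.2 ^ 2 * u p.2 ^ 2) (ν.prod μ) :=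
    (hk.pow_const 2).aemeasurable.mul (hu.comp_snd.pow_const 2)
  have hfinite : ∫⁻ x, ∫⁻ y, k x y ^ 2 * u y ^ 2 ∂μ ∂ν < ∞ := by
    calc ∫⁻ x, ∫⁻ y, k x y ^ 2 * u y ^ 2 ∂μ ∂ν
        = ∫⁻ y, (∫⁻ x, k x y ^ 2 ∂ν) * u y ^ 2 ∂μ := by
          rw [lintegral_lintegral_swap hmeas]
          refine lintegral_congr fun y => ?_
          rw [lintegral_mul_const _ (hk.of_uncurry_right.pow_const 2)]
      _ ≤ ∫⁻ y, N * u y ^ 2 ∂μ := by gcongr with y; exact hN y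
      _ < ∞ := by
          rw [lintegral_const_mul'' _ (hu.pow_const 2)]
          exact ENNReal.mul_lt_top ENNReal.coe_lt_top hu2
  filter_upwards [ae_lt_top' hmeas.lintegral_prod_right' hfinite.ne] with x hx
  have h := (sq_lintegral_pow_three_mul_le (hk.of_uncurry_left (x := x)) hu).trans
    (mul_le_mul_left (hM x) _)
  exact (ENNReal.pow_lt_top_iff.1
    (h.trans_lt (ENNReal.mul_lt_top ENNReal.coe_lt_top hx))).resolve_right two_ne_zero

lemma lintegral_sq_mul_lintegral_sq_mul_le [SFinite μ] (hk : Measurable k.uncurry)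
    (hksymm : ∀ x y, k x y = k y x) (hu : AEMeasurable u μ) {M : ℝ≥0}
    (hM : ∀ x, ∫⁻ y, k x y ^ 4 ∂μ ≤ M) (x : α) :
    ∫⁻ y, k x y ^ 2 * ∫⁻ z, k y z ^ 2 * u z ∂μ ∂μ ≤ M * ∫⁻ z, u z ∂μ := by
  have hcomp (z : α) : ∫⁻ y, k x y ^ 2 * k y z ^ 2 ∂μ ≤ M := by
    have h := sq_lintegral_mul_le (μ := μ) ((hk.of_uncurry_left (x := x)).pow_const 2).aemeasurable
      ((hk.of_uncurry_left (x := z)).pow_const 2).aemeasurable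
    simp only [← pow_mul, Nat.reduceMul] at h
    simp only [hksymm _ z]
    exact (ENNReal.pow_le_pow_left_iff two_ne_zero).1
      (h.trans ((mul_le_mul' (hM x) (hM z)).trans_eq (sq _).symm))
  have hmeas : AEMeasurable (fun p : α × α => k x p.1 ^ 2 * (k p.1 p.2 ^ 2 * u p.2)) (μ.prod μ) :=
    ((hk.of_uncurry_left.comp measurable_fst).pow_const 2).aemeasurable.mul
      ((hk.pow_const 2).aemeasurable.mul hu.comp_snd)
  calc ∫⁻ y, k x y ^ 2 * ∫⁻ z, k y z ^ 2 * u z ∂μ ∂μ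
      = ∫⁻ y, ∫⁻ z, k x y ^ 2 * (k y z ^ 2 * u z) ∂μ ∂μ := by
        refine lintegral_congr fun y => ?_
        have hy : AEMeasurable (fun z => k y z ^ 2 * u z) μ :=
          (hk.of_uncurry_left.pow_const 2).aemeasurable.mul hu
        rw [lintegral_const_mul'' _ hy]
    _ = ∫⁻ z, (∫⁻ y, k x y ^ 2 * k y z ^ 2 ∂μ) * u z ∂μ := by
        rw [lintegral_lintegral_swap hmeas]
        refine lintegral_congr fun z => ?_
        have hz : Measurable fun y => k x y ^ 2 * k y z ^ 2 :=
          (hk.of_uncurry_left.pow_const 2).mul (hk.of_uncurry_right.pow_const 2)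
        simp only [← mul_assoc]
        rw [lintegral_mul_const _ hz]
    _ ≤ ∫⁻ z, M * u z ∂μ := by gcongr with z; exact hcomp z
    _ = M * ∫⁻ z, u z ∂μ := lintegral_const_mul'' _ hu

lemma exists_ae_le_of_le_lintegral_pow_three_mul [SFinite μ] (hk : Measurable k.uncurry)
    (hksymm : ∀ x y, k x y = k y x) (hu : AEMeasurable u μ) (hu2 : ∫⁻ y, u y ^ 2 ∂μ < ∞)
    {M c : ℝ≥0} (hM : ∀ x, ∫⁻ y, k x y ^ 4 ∂μ ≤ M)
    (hle : ∀ᵐ x ∂μ, u x ≤ c * ∫⁻ y, k x y ^ 3 * u y ∂μ) :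
    ∃ C : ℝ≥0, ∀ᵐ x ∂μ, u x ≤ C := by
  have hsq : ∀ᵐ x ∂μ, u x ^ 2 ≤ c ^ 2 * M * ∫⁻ y, k x y ^ 2 * u y ^ 2 ∂μ := by
    filter_upwards [hle] with x hx
    calc u x ^ 2 ≤ (c * ∫⁻ y, k x y ^ 3 * u y ∂μ) ^ 2 := by gcongr
      _ = c ^ 2 * (∫⁻ y, k x y ^ 3 * u y ∂μ) ^ 2 := mul_pow _ _ _
      _ ≤ c ^ 2 * (M * ∫⁻ y, k x y ^ 2 * u y ^ 2 ∂μ) := by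
          gcongr
          exact (sq_lintegral_pow_three_mul_le hk.of_uncurry_left hu).trans
            (mul_le_mul_left (hM x) _)
      _ = _ := (mul_assoc _ _ _).symm
  set B : ℝ≥0∞ := (c ^ 2 * M) ^ 2 * (M * ∫⁻ y, u y ^ 2 ∂μ) with hB
  have hBtop : B ≠ ∞ := by finiteness
  have hbound : ∀ᵐ x ∂μ, u x ^ 2 ≤ B := by
    filter_upwards [hsq] with x hx
    have hiter : ∫⁻ y, k x y ^ 2 * u y ^ 2 ∂μ ≤
        c ^ 2 * M * ∫⁻ y, k x y ^ 2 * ∫⁻ z, k y z ^ 2 * u z ^ 2 ∂μ ∂μ := by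
      rw [← lintegral_const_mul' _ _ (by finiteness)]
      refine lintegral_mono_ae (hsq.mono fun y hy => ?_)
      exact (mul_le_mul_right hy _).trans_eq (mul_left_comm _ _ _)
    calc u x ^ 2 ≤ c ^ 2 * M * ∫⁻ y, k x y ^ 2 * u y ^ 2 ∂μ := hx
      _ ≤ c ^ 2 * M * (c ^ 2 * M * (M * ∫⁻ y, u y ^ 2 ∂μ)) := by
          gcongr
          exact hiter.trans (mul_le_mul_right
            (lintegral_sq_mul_lintegral_sq_mul_le hk hksymm (hu.pow_const 2) hM x) _)
      _ = B := by rw [hB]; ring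
  refine ⟨max 1 B.toNNReal, hbound.mono fun x hx => ?_⟩
  rw [ENNReal.coe_max, ENNReal.coe_toNNReal hBtop, ENNReal.coe_one, le_max_iff]
  rcases le_or_gt (u x) 1 with h | h
  · exact Or.inl h
  · exact Or.inr ((le_self_pow₀ h.le two_ne_zero).trans hx)

end Kernels

section RieszPotentials

variable {E : Type*} [NormedAddCommGroup E]

/-- The Riesz kernel `‖x - y‖ ^ (-a)`, with values in `[0, ∞]`. For `a ≠ 0` it is `0`, not `∞`, on
the diagonal. -/
noncomputable def rieszKernel (a : ℝ) (x y : E) : ℝ≥0∞ := ENNReal.ofReal (‖x - y‖ ^ (-a))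

/-- The weight `(1 + ‖x‖) ^ (-b)`, with values in `[0, ∞]`, measuring decay at infinity. -/
noncomputable def decayWeight (b : ℝ) (x : E) : ℝ≥0∞ := ENNReal.ofReal ((1 + ‖x‖) ^ (-b))

lemma rieszKernel_comm (a : ℝ) (x y : E) : rieszKernel a x y = rieszKernel a y x := by
  rw [rieszKernel, rieszKernel, norm_sub_rev]

lemma rieszKernel_pow (a : ℝ) (k : ℕ) (x y : E) :
    rieszKernel a x y ^ k = rieszKernel (k * a) x y := by
  rw [rieszKernel, rieszKernel, ← ENNReal.ofReal_pow (by positivity),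
    ← Real.rpow_mul_natCast (norm_nonneg _), neg_mul, mul_comm]

lemma decayWeight_mul_decayWeight (a b : ℝ) (x : E) :
    decayWeight a x * decayWeight b x = decayWeight (a + b) x := by
  have : 0 < 1 + ‖x‖ := by positivity
  rw [decayWeight, decayWeight, decayWeight, ← ENNReal.ofReal_mul (by positivity),
    ← Real.rpow_add this, neg_add]

lemma decayWeight_ne_zero (b : ℝ) (x : E) : decayWeight b x ≠ 0 :=
  (ENNReal.ofReal_pos.2 (by positivity)).ne'

lemma decayWeight_ne_top (b : ℝ) (x : E) : decayWeight b x ≠ ∞ := ENNReal.ofReal_ne_top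

lemma decayWeight_anti {a b : ℝ} (h : a ≤ b) (x : E) : decayWeight b x ≤ decayWeight a x :=
  ENNReal.ofReal_le_ofReal
    (Real.rpow_le_rpow_of_exponent_le (by linarith [norm_nonneg x]) (by linarith))

@[simp] lemma decayWeight_zero (x : E) : decayWeight 0 x = 1 := by simp [decayWeight]

lemma decayWeight_le_one {b : ℝ} (hb : 0 ≤ b) (x : E) : decayWeight b x ≤ 1 :=
  (decayWeight_anti hb x).trans_eq (decayWeight_zero x)

lemma rieszKernel_le_of_le_norm_sub {a t : ℝ} (ht : 0 ≤ t) (hta : t ≤ a) {x y : E}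
    (hxy : (1 + ‖x‖) / 2 ≤ ‖x - y‖) :
    rieszKernel a x y ≤ ENNReal.ofReal (3 ^ a) * decayWeight t x * decayWeight (a - t) y := by
  have hx : (1 + ‖x‖) / 3 ≤ ‖x - y‖ := by linarith [norm_nonneg x]
  have hy : (1 + ‖y‖) / 3 ≤ ‖x - y‖ := by linarith [norm_sub_norm_le y x, norm_sub_rev x y]
  have hpos : 0 < ‖x - y‖ := by linarith [norm_nonneg x]
  rw [rieszKernel, decayWeight, decayWeight, ← ENNReal.ofReal_mul (by positivity),
    ← ENNReal.ofReal_mul (by positivity)]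
  refine ENNReal.ofReal_le_ofReal ?_
  calc ‖x - y‖ ^ (-a) = ‖x - y‖ ^ (-t) * ‖x - y‖ ^ (-(a - t)) := by
        rw [← Real.rpow_add hpos]; congr 1; ring
    _ ≤ ((1 + ‖x‖) / 3) ^ (-t) * ((1 + ‖y‖) / 3) ^ (-(a - t)) := by
        gcongr ?_ * ?_
        · exact Real.rpow_le_rpow_of_nonpos (by positivity) hx (by linarith)
        · exact Real.rpow_le_rpow_of_nonpos (by positivity) hy (by linarith)
    _ = (3 ^ t * 3 ^ (a - t)) * (1 + ‖x‖) ^ (-t) * (1 + ‖y‖) ^ (-(a - t)) := by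
        rw [Real.div_rpow (by positivity) (by norm_num),
          Real.div_rpow (by positivity) (by norm_num),
          Real.rpow_neg (x := 3) (by norm_num), Real.rpow_neg (x := 3) (by norm_num),
          div_inv_eq_mul, div_inv_eq_mul]
        ring
    _ = 3 ^ a * (1 + ‖x‖) ^ (-t) * (1 + ‖y‖) ^ (-(a - t)) := by
        rw [← Real.rpow_add (by norm_num), add_sub_cancel]

variable [MeasurableSpace E] [BorelSpace E]

@[fun_prop]
lemma measurable_decayWeight (b : ℝ) : Measurable (decayWeight b : E → ℝ≥0∞) := by
  unfold decayWeight; fun_prop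

lemma measurable_rieszKernel_left (a : ℝ) (x : E) : Measurable (rieszKernel a x) := by
  unfold rieszKernel; fun_prop

variable {μ : Measure E}

lemma lintegral_withDensity_decayWeight (b : ℝ) (g : E → ℝ≥0∞) :
    ∫⁻ x, g x ∂μ.withDensity (decayWeight b) = ∫⁻ x, decayWeight b x * g x ∂μ :=
  lintegral_withDensity_eq_lintegral_mul_non_measurable _ (measurable_decayWeight b)
    (ae_of_all _ fun x => (decayWeight_ne_top b x).lt_top) g

lemma ae_withDensity_decayWeight_iff {b : ℝ} {p : E → Prop} :
    (∀ᵐ x ∂μ.withDensity (decayWeight b), p x) ↔ ∀ᵐ x ∂μ, p x := by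
  simp only [ae_withDensity_iff (measurable_decayWeight b), ne_eq, decayWeight_ne_zero,
    not_false_eq_true, true_imp_iff]

lemma lintegral_sq_withDensity_decayWeight_lt_top {u : E → ℝ≥0∞}
    (hu2 : ∫⁻ x, u x ^ 2 ∂μ < ∞) {b : ℝ} (hb : 0 ≤ b) :
    ∫⁻ x, u x ^ 2 ∂μ.withDensity (decayWeight b) < ∞ := by
  rw [lintegral_withDensity_decayWeight]
  exact (lintegral_mono fun x => mul_le_of_le_one_left' (decayWeight_le_one hb x)).trans_lt hu2

lemma lintegral_rieszKernel_mul_decayWeight_mul (a ρ : ℝ) (u : E → ℝ≥0∞) (x : E) :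
    ∫⁻ y, rieszKernel a x y * (decayWeight ρ y * u y) ∂μ =
      ∫⁻ y, rieszKernel (a / 3) x y ^ 3 * u y ∂μ.withDensity (decayWeight ρ) := by
  rw [lintegral_withDensity_decayWeight]
  refine lintegral_congr fun y => ?_
  rw [rieszKernel_pow, Nat.cast_ofNat, mul_div_cancel₀ a three_ne_zero, mul_left_comm]

variable [NormedSpace ℝ E] [FiniteDimensional ℝ E] (μ) [μ.IsAddHaarMeasure]

lemma measurable_rieszKernel (a : ℝ) :
    Measurable (Function.uncurry (rieszKernel a : E → E → ℝ≥0∞)) := by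
  unfold rieszKernel Function.uncurry; fun_prop

lemma lintegral_decayWeight_lt_top {b : ℝ} (hb : finrank ℝ E < b) :
    ∫⁻ y, decayWeight b y ∂μ < ∞ := finite_integral_one_add_norm hb

variable [Nontrivial E]

lemma exists_lintegral_ball_rieszKernel_eq {a : ℝ} (ha : a < finrank ℝ E) :
    ∃ C : ℝ≥0, ∀ (x : E) {r : ℝ}, 0 < r → ∫⁻ y in Metric.ball x r, rieszKernel a x y ∂μ =
      C * ENNReal.ofReal (r ^ (finrank ℝ E - a)) := by
  have hI (r : ℝ) : IntegrableOn (fun z : E => ‖z‖ ^ (-a)) (Metric.ball 0 r) μ :=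
    integrableOn_ball_of_norm_le_rpow (C := 1) Module.finrank_pos ha
      (ae_of_all _ fun z => by rw [one_mul, Real.norm_of_nonneg (by positivity)])
      (Measurable.aestronglyMeasurable (by fun_prop))
  set c := ∫ z in Metric.ball (0 : E) 1, ‖z‖ ^ (-a) ∂μ
  have hscale {r : ℝ} (hr : 0 < r) :
      ∫ z in Metric.ball (0 : E) r, ‖z‖ ^ (-a) ∂μ = c * r ^ (finrank ℝ E - a) := by
    have h := Measure.setIntegral_comp_smul_of_pos μ (fun z : E => ‖z‖ ^ (-a)) (Metric.ball 0 1) hr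
    simp only [norm_smul, Real.norm_of_nonneg hr.le, Real.mul_rpow hr.le (norm_nonneg _),
      integral_const_mul, smul_unitBall hr.ne', smul_eq_mul] at h
    rw [← mul_inv_cancel_left₀ (pow_ne_zero (finrank ℝ E) hr.ne')
        (∫ z in Metric.ball (0 : E) r, _ ∂μ),
      ← h, sub_eq_add_neg, Real.rpow_add hr, Real.rpow_natCast]
    ring
  refine ⟨c.toNNReal, fun x r hr => ?_⟩
  calc ∫⁻ y in Metric.ball x r, rieszKernel a x y ∂μ
      = ∫⁻ z in Metric.ball 0 r, ENNReal.ofReal (‖z‖ ^ (-a)) ∂μ := by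
        rw [← lintegral_indicator measurableSet_ball, ← lintegral_indicator measurableSet_ball,
          ← lintegral_sub_left_eq_self _ x]
        refine lintegral_congr fun y => ?_
        simp only [Set.indicator, Metric.mem_ball', dist_eq_norm, rieszKernel, sub_sub_cancel,
          zero_sub, norm_neg]
    _ = ENNReal.ofReal (c * r ^ (finrank ℝ E - a)) := by
        rw [← ofReal_integral_eq_lintegral_ofReal (hI r) (ae_of_all _ fun z => by positivity),
          hscale hr]
    _ = _ := ENNReal.ofReal_mul (integral_nonneg fun z => by positivity)

lemma exists_lintegral_ball_rieszKernel_mul_decayWeight_le {a b : ℝ} (ha : a < finrank ℝ E)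
    (hb : 0 ≤ b) :
    ∃ C : ℝ≥0, ∀ x : E, ∫⁻ y in Metric.ball x ((1 + ‖x‖) / 2),
      rieszKernel a x y * decayWeight b y ∂μ ≤ C * decayWeight (a + b - finrank ℝ E) x := by
  obtain ⟨C, hC⟩ := exists_lintegral_ball_rieszKernel_eq μ ha
  refine ⟨C * (2 ^ (a + b - finrank ℝ E) : ℝ).toNNReal, fun x => ?_⟩
  set r : ℝ := (1 + ‖x‖) / 2 with hr
  have hr0 : 0 < r := by positivity
  calc ∫⁻ y in Metric.ball x r, rieszKernel a x y * decayWeight b y ∂μ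
      ≤ ∫⁻ y in Metric.ball x r, rieszKernel a x y * ENNReal.ofReal (r ^ (-b)) ∂μ := by
        refine setLIntegral_mono' measurableSet_ball fun y hy => ?_
        rw [Metric.mem_ball', dist_eq_norm] at hy
        gcongr
        refine ENNReal.ofReal_le_ofReal (Real.rpow_le_rpow_of_nonpos hr0 ?_ (by linarith))
        linarith [norm_sub_norm_le x y]
    _ = C * ENNReal.ofReal (r ^ (-(a + b - finrank ℝ E))) := by
        rw [lintegral_mul_const _ (measurable_rieszKernel_left a x), hC x hr0, mul_assoc,
          ← ENNReal.ofReal_mul (by positivity), ← Real.rpow_add hr0]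
        congr 3; ring
    _ = _ := by
        rw [hr, Real.div_rpow (by positivity) zero_le_two, Real.rpow_neg zero_le_two,
          div_inv_eq_mul, mul_comm _ (2 ^ _ : ℝ), ENNReal.ofReal_mul (by positivity), decayWeight,
          ENNReal.coe_mul, mul_assoc]
        rfl

lemma exists_lintegral_rieszKernel_mul_decayWeight_le {a b t : ℝ} (ht : 0 ≤ t) (hta : t ≤ a)
    (ha : a < finrank ℝ E) (habt : finrank ℝ E < a + b - t) :
    ∃ C : ℝ≥0, ∀ x : E, ∫⁻ y, rieszKernel a x y * decayWeight b y ∂μ ≤ C * decayWeight t x := by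
  obtain ⟨C, hC⟩ := exists_lintegral_ball_rieszKernel_mul_decayWeight_le μ ha
    (show 0 ≤ b by linarith)
  have hfin : ∫⁻ y : E, decayWeight (a + b - t) y ∂μ < ∞ := lintegral_decayWeight_lt_top μ habt
  lift ∫⁻ y : E, decayWeight (a + b - t) y ∂μ to ℝ≥0 using hfin.ne with D hD
  refine ⟨C + (3 ^ a : ℝ).toNNReal * D, fun x => ?_⟩
  set B := Metric.ball x ((1 + ‖x‖) / 2)
  have hfar : ∫⁻ y in Bᶜ, rieszKernel a x y * decayWeight b y ∂μ ≤
      (3 ^ a : ℝ).toNNReal * D * decayWeight t x := by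
    calc ∫⁻ y in Bᶜ, rieszKernel a x y * decayWeight b y ∂μ
        ≤ ∫⁻ y in Bᶜ, ENNReal.ofReal (3 ^ a) * decayWeight t x * decayWeight (a + b - t) y ∂μ := by
          refine setLIntegral_mono' measurableSet_ball.compl fun y hy => ?_
          rw [Set.mem_compl_iff, Metric.mem_ball', dist_eq_norm, not_lt] at hy
          rw [show a + b - t = a - t + b by ring, ← decayWeight_mul_decayWeight, ← mul_assoc]
          gcongr
          exact rieszKernel_le_of_le_norm_sub ht hta hy
      _ ≤ ∫⁻ y, ENNReal.ofReal (3 ^ a) * decayWeight t x * decayWeight (a + b - t) y ∂μ :=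
          setLIntegral_le_lintegral _ _
      _ = _ := by
          rw [lintegral_const_mul _ (measurable_decayWeight _), ← hD, mul_right_comm]
          rfl
  calc ∫⁻ y, rieszKernel a x y * decayWeight b y ∂μ
      = (∫⁻ y in B, rieszKernel a x y * decayWeight b y ∂μ) +
          ∫⁻ y in Bᶜ, rieszKernel a x y * decayWeight b y ∂μ :=
        (lintegral_add_compl _ measurableSet_ball).symm
    _ ≤ C * decayWeight t x + (3 ^ a : ℝ).toNNReal * D * decayWeight t x := by
        gcongr
        exact (hC x).trans (mul_le_mul_right (decayWeight_anti (by linarith) x) _)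
    _ = _ := by push_cast; rw [add_mul]

end RieszPotentials

section Bootstrap

variable {E : Type*} [NormedAddCommGroup E] [NormedSpace ℝ E] [FiniteDimensional ℝ E] [Nontrivial E]
  [MeasurableSpace E] [BorelSpace E] {μ : Measure E} [μ.IsAddHaarMeasure] {a ρ : ℝ} {c : ℝ≥0}
  {u : E → ℝ≥0∞}

lemma exists_lintegral_rieszKernel_pow_le {k : ℕ} {b : ℝ} (ha : 0 ≤ a)
    (hka : k * a < finrank ℝ E) (hb : finrank ℝ E < k * a + b) :
    ∃ M : ℝ≥0, ∀ x, ∫⁻ y, rieszKernel a x y ^ k ∂μ.withDensity (decayWeight b) ≤ M := by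
  obtain ⟨M, hM⟩ := exists_lintegral_rieszKernel_mul_decayWeight_le μ le_rfl
    (show 0 ≤ k * a by positivity) hka (by rwa [sub_zero])
  refine ⟨M, fun x => ?_⟩
  rw [lintegral_withDensity_decayWeight]
  simpa only [rieszKernel_pow, mul_comm (decayWeight b _), decayWeight_zero, mul_one] using hM x

lemma ae_lintegral_rieszKernel_mul_lt_top (ha : 0 ≤ a) (han : 4 * (a / 3) < finrank ℝ E)
    (haρ : finrank ℝ E < a + ρ) (hu : AEMeasurable u μ) (hu2 : ∫⁻ x, u x ^ 2 ∂μ < ∞) :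
    ∀ᵐ x ∂μ, ∫⁻ y, rieszKernel a x y * (decayWeight ρ y * u y) ∂μ < ∞ := by
  obtain ⟨M, hM⟩ := exists_lintegral_rieszKernel_pow_le (μ := μ) (a := a / 3) (k := 4) (b := ρ)
    (by positivity) (by exact_mod_cast han) (by push_cast; linarith)
  obtain ⟨N, hN⟩ := exists_lintegral_rieszKernel_pow_le (μ := μ) (a := a / 3) (k := 2)
    (b := finrank ℝ E + 1) (by positivity) (by push_cast; linarith) (by push_cast; linarith)
  simp only [lintegral_rieszKernel_mul_decayWeight_mul]
  rw [← ae_withDensity_decayWeight_iff (b := finrank ℝ E + 1)]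
  refine ae_lintegral_pow_three_mul_lt_top (measurable_rieszKernel _)
    (hu.mono_ac (withDensity_absolutelyContinuous _ _))
    (lintegral_sq_withDensity_decayWeight_lt_top hu2 (by linarith)) hM
    (N := N) fun y => ?_
  simp only [rieszKernel_comm _ _ y]
  exact hN y

lemma exists_ae_le_of_le_lintegral_rieszKernel (ha : 0 ≤ a) (han : 4 * (a / 3) < finrank ℝ E)
    (haρ : finrank ℝ E < a + ρ) (hu : AEMeasurable u μ) (hu2 : ∫⁻ x, u x ^ 2 ∂μ < ∞)
    (hle : ∀ᵐ x ∂μ, u x ≤ c * ∫⁻ y, rieszKernel a x y * (decayWeight ρ y * u y) ∂μ) :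
    ∃ C : ℝ≥0, ∀ᵐ x ∂μ, u x ≤ C := by
  obtain ⟨M, hM⟩ := exists_lintegral_rieszKernel_pow_le (μ := μ) (a := a / 3) (k := 4) (b := ρ)
    (by positivity) (by exact_mod_cast han) (by push_cast; linarith)
  simp only [lintegral_rieszKernel_mul_decayWeight_mul] at hle
  rw [← ae_withDensity_decayWeight_iff (b := ρ)] at hle
  obtain ⟨C, hC⟩ := exists_ae_le_of_le_lintegral_pow_three_mul (measurable_rieszKernel _)
    (rieszKernel_comm _) (hu.mono_ac (withDensity_absolutelyContinuous _ _))
    (lintegral_sq_withDensity_decayWeight_lt_top hu2 (by linarith)) hM hle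
  exact ⟨C, ae_withDensity_decayWeight_iff.1 hC⟩

lemma exists_ae_le_decayWeight_of_ae_le_decayWeight {s t : ℝ} (hs : 0 ≤ s) (hsa : s ≤ a)
    (han : a < finrank ℝ E) (hst : finrank ℝ E < a + (ρ + t) - s)
    (hle : ∀ᵐ x ∂μ, u x ≤ c * ∫⁻ y, rieszKernel a x y * (decayWeight ρ y * u y) ∂μ)
    (hu : ∃ C : ℝ≥0, ∀ᵐ x ∂μ, u x ≤ C * decayWeight t x) :
    ∃ C : ℝ≥0, ∀ᵐ x ∂μ, u x ≤ C * decayWeight s x := by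
  obtain ⟨C, hC⟩ := hu
  obtain ⟨D, hD⟩ := exists_lintegral_rieszKernel_mul_decayWeight_le μ hs hsa han hst
  refine ⟨c * (C * D), hle.mono fun x hx => hx.trans ?_⟩
  calc c * ∫⁻ y, rieszKernel a x y * (decayWeight ρ y * u y) ∂μ
      ≤ c * ∫⁻ y, C * (rieszKernel a x y * decayWeight (ρ + t) y) ∂μ := by
        gcongr 1
        refine lintegral_mono_ae (hC.mono fun y hy => ?_)
        calc rieszKernel a x y * (decayWeight ρ y * u y)
            ≤ rieszKernel a x y * (decayWeight ρ y * (C * decayWeight t y)) := by gcongr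
          _ = _ := by rw [← decayWeight_mul_decayWeight]; ring
    _ = c * (C * ∫⁻ y, rieszKernel a x y * decayWeight (ρ + t) y ∂μ) := by
        rw [lintegral_const_mul' _ _ ENNReal.coe_ne_top]
    _ ≤ c * (C * (D * decayWeight s x)) := by gcongr; exact hD x
    _ = _ := by push_cast; ring

lemma exists_ae_le_decayWeight_of_le_lintegral_rieszKernel (ha : 0 ≤ a)
    (han : 4 * (a / 3) < finrank ℝ E) (haρ : finrank ℝ E < a + ρ) (hu : AEMeasurable u μ)
    (hu2 : ∫⁻ x, u x ^ 2 ∂μ < ∞)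
    (hle : ∀ᵐ x ∂μ, u x ≤ c * ∫⁻ y, rieszKernel a x y * (decayWeight ρ y * u y) ∂μ) :
    ∃ C : ℝ≥0, ∀ᵐ x ∂μ, u x ≤ C * decayWeight a x := by
  obtain ⟨δ, hδ0, hδ⟩ := exists_between (sub_pos.2 haρ)
  have hiter (k : ℕ) : ∃ C : ℝ≥0, ∀ᵐ x ∂μ, u x ≤ C * decayWeight (min (k * δ) a) x := by
    induction k with
    | zero =>
      simpa only [Nat.cast_zero, zero_mul, min_eq_left ha, decayWeight_zero, mul_one] using
        exists_ae_le_of_le_lintegral_rieszKernel ha han haρ hu hu2 hle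
    | succ k ih =>
      have hstep : min ((k + 1 : ℕ) * δ) a ≤ min (k * δ) a + δ := by
        rw [← min_add_add_right]
        push_cast
        exact min_le_min (by linarith) (by linarith)
      exact exists_ae_le_decayWeight_of_ae_le_decayWeight (le_min (by positivity) ha)
        (min_le_right _ _) (by linarith) (by linarith) hle ih
  obtain ⟨k, hk⟩ := exists_nat_ge (a / δ)
  rw [div_le_iff₀ hδ0] at hk
  simpa only [min_eq_right hk] using hiter k

end Bootstrap

section RadialIdentity

open scoped ContDiff InnerProductSpace

variable {E S : Type*} [NormedAddCommGroup E] [InnerProductSpace ℝ E]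
  [NormedAddCommGroup S] [NormedSpace ℝ S]

/-- `c` is a Clifford multiplication of the Euclidean space `E` on the space of spinors `S`. The
sign convention `c v * c v = -‖v‖ ^ 2` makes `∑ j, c (e j) ∂ⱼ` the Dirac operator; for the Dirac
matrices it is realised by `c v = (1 / i) α · v`. -/
structure IsCliffordMul (c : E →L[ℝ] S →L[ℝ] S) : Prop where
  apply_apply (v : E) (s : S) : c v (c v s) = -(‖v‖ ^ 2 • s)
  norm_apply (v : E) (s : S) : ‖c v s‖ = ‖v‖ * ‖s‖

/-- The components, in the direction `v`, of the radial vector field `(y - x) g (‖y - x‖ ^ 2)`. They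
are the test functions from which the fundamental solution of the Dirac operator is recovered. -/
def radialTest (g : ℝ → ℝ) (x v y : E) : ℝ := ⟪v, y - x⟫_ℝ * g (‖y - x‖ ^ 2)

variable {c : E →L[ℝ] S →L[ℝ] S} {g : ℝ → ℝ} {R : ℝ}

lemma contDiff_radialTest (hg : ContDiff ℝ ∞ g) (x v : E) : ContDiff ℝ ∞ (radialTest g x v) :=
  (contDiff_const.inner ℝ (contDiff_id.sub contDiff_const)).mul
    (hg.comp ((contDiff_id.sub contDiff_const).norm_sq ℝ))

lemma sum_inner_smul_clifford {ι : Type*} [Fintype ι] (e : OrthonormalBasis ι ℝ E)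
    (c : E →L[ℝ] S →L[ℝ] S) (v : E) (s : S) : ∑ k, ⟪e k, v⟫_ℝ • c (e k) s = c v s := by
  conv_rhs => rw [← e.sum_repr' v]
  simp only [map_sum, sum_apply, map_smul, smul_apply]

variable [FiniteDimensional ℝ E]

/-- `f` solves `D f + F = 0` in the sense of distributions, where `D = ∑ j, c (e j) ∂ⱼ` is the Dirac
operator of the Clifford multiplication `c`. -/
def IsWeakDiracSolution [MeasurableSpace E] [BorelSpace E] (c : E →L[ℝ] S →L[ℝ] S) (f F : E → S) :
    Prop :=
  ∀ φ : E → ℝ, ContDiff ℝ ∞ φ → HasCompactSupport φ → ∫ y, c (∇ φ y) (f y) = ∫ y, φ y • F y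

lemma continuous_gradient {φ : E → ℝ} (hφ : ContDiff ℝ ∞ φ) : Continuous (∇ φ) :=
  (InnerProductSpace.toDual ℝ E).symm.continuous.comp (hφ.continuous_fderiv (by simp))

lemma hasCompactSupport_gradient {φ : E → ℝ} (hφ : HasCompactSupport φ) :
    HasCompactSupport (∇ φ) :=
  (hφ.fderiv ℝ).comp_left (g := (InnerProductSpace.toDual ℝ E).symm) (map_zero _)

lemma hasCompactSupport_radialTest (hR : ∀ s, R ^ 2 ≤ s → g s = 0) (x v : E) :
    HasCompactSupport (radialTest g x v) := by
  refine HasCompactSupport.intro (isCompact_closedBall x |R|) fun y hy => ?_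
  rw [Metric.mem_closedBall, dist_eq_norm, not_le] at hy
  rw [radialTest, hR _ (by rw [← sq_abs R]; gcongr), mul_zero]

lemma gradient_radialTest (hg : Differentiable ℝ g) (x v y : E) :
    ∇ (radialTest g x v) y =
      g (‖y - x‖ ^ 2) • v + (2 * deriv g (‖y - x‖ ^ 2) * ⟪v, y - x⟫_ℝ) • (y - x) := by
  have hinner : HasFDerivAt (fun y : E => ⟪v, y - x⟫_ℝ) (innerSL ℝ v) y :=
    (innerSL ℝ v).hasFDerivAt.comp y ((hasFDerivAt_id y).sub_const x)
  have hsq : HasFDerivAt (fun y : E => ‖y - x‖ ^ 2) (2 • innerSL ℝ (y - x)) y := by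
    simpa using ((hasFDerivAt_id y).sub_const x).norm_sq
  refine HasGradientAt.gradient (hasGradientAt_iff_hasFDerivAt.2 ?_)
  refine (hinner.mul ((hg _).hasDerivAt.comp_hasFDerivAt y hsq)).congr_fderiv ?_
  ext w
  simp only [add_apply, smul_apply, innerSL_apply_apply,
    nsmul_eq_mul, smul_eq_mul, InnerProductSpace.toDual_apply_apply, inner_add_left,
    real_inner_smul_left, Function.comp_apply]
  push_cast
  ring

lemma sum_clifford_gradient_radialTest (hc : IsCliffordMul c) (hg : Differentiable ℝ g) (x y : E)
    (s : S) :
    ∑ k, c (stdOrthonormalBasis ℝ E k) (c (∇ (radialTest g x (stdOrthonormalBasis ℝ E k)) y) s) =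
      -((2 * ‖y - x‖ ^ 2 * deriv g (‖y - x‖ ^ 2) + finrank ℝ E * g (‖y - x‖ ^ 2)) • s) := by
  set e := stdOrthonormalBasis ℝ E
  set z := y - x
  calc ∑ k, c (e k) (c (∇ (radialTest g x (e k)) y) s)
      = ∑ k, (g (‖z‖ ^ 2) • c (e k) (c (e k) s) +
          (2 * deriv g (‖z‖ ^ 2)) • ⟪e k, z⟫_ℝ • c (e k) (c z s)) := by
        refine Finset.sum_congr rfl fun k _ => ?_
        simp only [gradient_radialTest hg, map_add, map_smul, add_apply,
          smul_apply, smul_smul, z]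
    _ = -((finrank ℝ E * g (‖z‖ ^ 2)) • s) - (2 * deriv g (‖z‖ ^ 2) * ‖z‖ ^ 2) • s := by
        rw [Finset.sum_add_distrib, ← Finset.smul_sum, ← Finset.smul_sum, sum_inner_smul_clifford]
        simp only [hc.apply_apply, e.norm_eq_one, one_pow, one_smul, Finset.sum_const,
          Finset.card_univ, Fintype.card_fin, ← Nat.cast_smul_eq_nsmul ℝ, smul_neg, smul_smul,
          sub_eq_add_neg, mul_comm (g _)]
    _ = _ := by rw [← neg_add', ← add_smul]; congr 2; ring

lemma sum_clifford_radialTest_smul (g : ℝ → ℝ) (x y : E) (s : S) :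
    ∑ k, c (stdOrthonormalBasis ℝ E k) (radialTest g x (stdOrthonormalBasis ℝ E k) y • s) =
      -(g (‖x - y‖ ^ 2) • c (x - y) s) := by
  rw [norm_sub_rev, ← neg_sub y x, map_neg, neg_apply, smul_neg, neg_neg,
    ← sum_inner_smul_clifford (stdOrthonormalBasis ℝ E) c (y - x) s, Finset.smul_sum]
  simp only [map_smul, smul_smul, radialTest, mul_comm]

variable [MeasurableSpace E] [BorelSpace E] {f F : E → S}

lemma integrable_clifford_apply (hf : LocallyIntegrable f) {V : E → E} (hV : Continuous V)
    (hVc : HasCompactSupport V) : Integrable fun y => c (V y) (f y) := by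
  set e := stdOrthonormalBasis ℝ E
  have hsum (y : E) : c (V y) (f y) = ∑ k, c (e k) (⟪e k, V y⟫_ℝ • f y) := by
    simp only [map_smul, sum_inner_smul_clifford]
  simp only [hsum]
  refine integrable_finsetSum _ fun k _ => (c (e k)).integrable_comp ?_
  exact hf.integrable_smul_left_of_hasCompactSupport (continuous_const.inner hV)
    (hVc.comp_left (g := fun v => ⟪e k, v⟫_ℝ) (inner_zero_right _))

variable [CompleteSpace S]

lemma IsWeakDiracSolution.integral_radial_smul (h : IsWeakDiracSolution c f F)
    (hc : IsCliffordMul c) (hf : LocallyIntegrable f) (hF : LocallyIntegrable F)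
    (hg : ContDiff ℝ ∞ g) (hR : ∀ s, R ^ 2 ≤ s → g s = 0) (x : E) :
    ∫ y, (2 * ‖y - x‖ ^ 2 * deriv g (‖y - x‖ ^ 2) + finrank ℝ E * g (‖y - x‖ ^ 2)) • f y =
      ∫ y, g (‖x - y‖ ^ 2) • c (x - y) (F y) := by
  set e := stdOrthonormalBasis ℝ E
  have hφ (k) := contDiff_radialTest hg x (e k)
  have hφc (k) := hasCompactSupport_radialTest hR x (e k)
  have hleft (k) : Integrable fun y => c (∇ (radialTest g x (e k)) y) (f y) :=
    integrable_clifford_apply hf (continuous_gradient (hφ k)) (hasCompactSupport_gradient (hφc k))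
  have hright (k) : Integrable fun y => radialTest g x (e k) y • F y :=
    hF.integrable_smul_left_of_hasCompactSupport (hφ k).continuous (hφc k)
  rw [← neg_inj, ← integral_neg, ← integral_neg]
  calc ∫ y, -((2 * ‖y - x‖ ^ 2 * deriv g (‖y - x‖ ^ 2) + finrank ℝ E * g (‖y - x‖ ^ 2)) • f y)
      = ∫ y, ∑ k, c (e k) (c (∇ (radialTest g x (e k)) y) (f y)) := by
        simp only [← sum_clifford_gradient_radialTest hc (hg.differentiable (by simp)), e]
    _ = ∑ k, c (e k) (∫ y, c (∇ (radialTest g x (e k)) y) (f y)) := by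
        rw [integral_finsetSum _ fun k _ => (c (e k)).integrable_comp (hleft k)]
        exact Finset.sum_congr rfl fun k _ => (c (e k)).integral_comp_comm (hleft k)
    _ = ∑ k, c (e k) (∫ y, radialTest g x (e k) y • F y) :=
        Finset.sum_congr rfl fun k _ => by rw [h _ (hφ k) (hφc k)]
    _ = ∫ y, ∑ k, c (e k) (radialTest g x (e k) y • F y) := by
        rw [integral_finsetSum _ fun k _ => (c (e k)).integrable_comp (hright k)]
        exact Finset.sum_congr rfl fun k _ => ((c (e k)).integral_comp_comm (hright k)).symm
    _ = ∫ y, -(g (‖x - y‖ ^ 2) • c (x - y) (F y)) := by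
        simp only [← sum_clifford_radialTest_smul, e]

end RadialIdentity

section SmoothCutoff

open scoped ContDiff

/-- A smooth step rising from `0` on `s ≤ 1` to `1` on `2 ≤ s`. -/
noncomputable def smoothStep (s : ℝ) : ℝ := Real.smoothTransition (s - 1)

lemma smoothStep_of_le_one {s : ℝ} (h : s ≤ 1) : smoothStep s = 0 :=
  Real.smoothTransition.zero_of_nonpos (by linarith)

lemma smoothStep_of_two_le {s : ℝ} (h : 2 ≤ s) : smoothStep s = 1 :=
  Real.smoothTransition.one_of_one_le (by linarith)

lemma norm_smoothStep_le_one (s : ℝ) : ‖smoothStep s‖ ≤ 1 := by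
  rw [smoothStep, Real.norm_of_nonneg (Real.smoothTransition.nonneg _)]
  exact Real.smoothTransition.le_one _

lemma abs_smoothStep_sub_smoothStep_le (s t : ℝ) : |smoothStep s - smoothStep t| ≤ 1 := by
  rw [smoothStep, smoothStep]
  exact abs_sub_le_of_nonneg_of_le (Real.smoothTransition.nonneg _) (Real.smoothTransition.le_one _)
    (Real.smoothTransition.nonneg _) (Real.smoothTransition.le_one _)

lemma contDiff_smoothStep : ContDiff ℝ ∞ smoothStep :=
  Real.smoothTransition.contDiff.comp (contDiff_id.sub contDiff_const)

lemma differentiable_smoothStep : Differentiable ℝ smoothStep :=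
  contDiff_smoothStep.differentiable (by simp)

lemma continuous_deriv_smoothStep : Continuous (deriv smoothStep) :=
  contDiff_smoothStep.continuous_deriv (by simp)

lemma deriv_smoothStep_nonneg (s : ℝ) : 0 ≤ deriv smoothStep s :=
  Monotone.deriv_nonneg fun _ _ h => Real.smoothTransition.monotone (by linarith)

lemma deriv_smoothStep_of_lt_one {s : ℝ} (h : s < 1) : deriv smoothStep s = 0 := by
  have : smoothStep =ᶠ[𝓝 s] fun _ => 0 := by
    filter_upwards [Iio_mem_nhds h] with t ht using smoothStep_of_le_one (le_of_lt ht)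
  rw [this.deriv_eq, deriv_const]

lemma deriv_smoothStep_of_two_lt {s : ℝ} (h : 2 < s) : deriv smoothStep s = 0 := by
  have : smoothStep =ᶠ[𝓝 s] fun _ => 1 := by
    filter_upwards [Ioi_mem_nhds h] with t ht using smoothStep_of_two_le (le_of_lt ht)
  rw [this.deriv_eq, deriv_const]

lemma exists_mul_deriv_smoothStep_le : ∃ B : ℝ, 0 ≤ B ∧ ∀ s, s * deriv smoothStep s ≤ B := by
  obtain ⟨B, hB⟩ := (isCompact_Icc (a := (1 : ℝ)) (b := 2)).exists_bound_of_continuousOn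
    (continuous_id.mul continuous_deriv_smoothStep).continuousOn
  have hB0 : 0 ≤ B := (norm_nonneg _).trans (hB 1 (by norm_num))
  refine ⟨B, hB0, fun s => ?_⟩
  rcases lt_or_ge s 1 with h1 | h1
  · rwa [deriv_smoothStep_of_lt_one h1, mul_zero]
  rcases lt_or_ge 2 s with h2 | h2
  · rwa [deriv_smoothStep_of_two_lt h2, mul_zero]
  exact (le_abs_self _).trans (hB s ⟨h1, h2⟩)

/-- The profile `s ^ (-d / 2)`, that is `t ↦ t ^ (-d)` as a function of `s = t ^ 2`, smoothly cut
off for `t ≤ r`. -/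
noncomputable def cutoffProfile (d r s : ℝ) : ℝ := s ^ (-(d / 2)) * smoothStep (s / r ^ 2)

/-- The function `2 s g' + d g` for the profile `g = cutoffProfile d r`. As a function of
`s = ‖z‖ ^ 2` in dimension `d` it is the divergence of the vector field `g (‖z‖ ^ 2) z`, which away
from the origin is divergence free before the cutoff: the density concentrates in `‖z‖ ≤ 2 r`. -/
noncomputable def cutoffDensity (d r s : ℝ) : ℝ :=
  2 * s ^ (-(d / 2)) * (s / r ^ 2 * deriv smoothStep (s / r ^ 2))

variable {d r s t : ℝ}

lemma cutoffProfile_eventuallyEq_zero (d : ℝ) (h : s / r ^ 2 < 1) :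
    cutoffProfile d r =ᶠ[𝓝 s] fun _ => 0 := by
  have : ∀ᶠ t in 𝓝 s, t / r ^ 2 < 1 :=
    (continuous_id.div_const (r ^ 2)).continuousAt.eventually_lt_const h
  filter_upwards [this] with t ht
  rw [cutoffProfile, smoothStep_of_le_one ht.le, mul_zero]

lemma pos_of_one_le_div_sq (h : 1 ≤ s / r ^ 2) : 0 < s := by
  by_contra! hs
  linarith [div_nonpos_of_nonpos_of_nonneg hs (sq_nonneg r)]

lemma contDiff_cutoffProfile (d r : ℝ) : ContDiff ℝ ∞ (cutoffProfile d r) := by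
  rw [contDiff_iff_contDiffAt]
  intro s
  rcases lt_or_ge (s / r ^ 2) 1 with h | h
  · exact contDiffAt_const.congr_of_eventuallyEq (cutoffProfile_eventuallyEq_zero d h)
  · exact (Real.contDiffAt_rpow_const_of_ne (pos_of_one_le_div_sq h).ne').mul
      (contDiff_smoothStep.comp (contDiff_id.div_const _)).contDiffAt

lemma two_mul_deriv_cutoffProfile_add (d r s : ℝ) :
    2 * s * deriv (cutoffProfile d r) s + d * cutoffProfile d r s = cutoffDensity d r s := by
  rcases lt_or_ge (s / r ^ 2) 1 with h | h
  · rw [(cutoffProfile_eventuallyEq_zero d h).deriv_eq, cutoffDensity, deriv_smoothStep_of_lt_one h,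
      (cutoffProfile_eventuallyEq_zero d h).eq_of_nhds]
    simp
  · have hs := pos_of_one_le_div_sq h
    have hpow : HasDerivAt (fun t : ℝ => t ^ (-(d / 2))) _ s :=
      Real.hasDerivAt_rpow_const (Or.inl hs.ne')
    have hstep : HasDerivAt (fun t : ℝ => smoothStep (t / r ^ 2))
        (deriv smoothStep (s / r ^ 2) * (1 / r ^ 2)) s :=
      (differentiable_smoothStep _).hasDerivAt.comp s ((hasDerivAt_id s).div_const (r ^ 2))
    have hderiv : deriv (cutoffProfile d r) s = _ := (hpow.mul hstep).deriv
    rw [hderiv, cutoffProfile, cutoffDensity, Real.rpow_sub_one hs.ne']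
    field_simp
    ring

lemma cutoffDensity_nonneg (d r : ℝ) (hs : 0 ≤ s) : 0 ≤ cutoffDensity d r s := by
  have := deriv_smoothStep_nonneg (s / r ^ 2)
  unfold cutoffDensity; positivity

lemma sq_rpow_neg_div_two (d : ℝ) (ht : 0 ≤ t) : (t ^ 2) ^ (-(d / 2)) = t ^ (-d) := by
  rw [← Real.rpow_natCast_mul ht]
  congr 1
  push_cast
  ring

lemma cutoffDensity_of_lt (d : ℝ) (hr : 0 < r) (h : 2 * r < t) : cutoffDensity d r (t ^ 2) = 0 := by
  have : 2 < t ^ 2 / r ^ 2 := by rw [lt_div_iff₀ (by positivity)]; nlinarith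
  rw [cutoffDensity, deriv_smoothStep_of_two_lt this, mul_zero, mul_zero]

lemma cutoffDensity_of_lt_radius (d : ℝ) (ht : 0 ≤ t) (h : t < r) :
    cutoffDensity d r (t ^ 2) = 0 := by
  have : t ^ 2 / r ^ 2 < 1 := by
    rw [div_lt_one (pow_pos (ht.trans_lt h) 2)]
    gcongr
  rw [cutoffDensity, deriv_smoothStep_of_lt_one this, mul_zero, mul_zero]

lemma exists_cutoffDensity_le (hd : 0 ≤ d) : ∃ B : ℝ, 0 ≤ B ∧ ∀ r t : ℝ, 0 < r → 0 ≤ t →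
    cutoffDensity d r (t ^ 2) ≤ B * r ^ (-d) := by
  obtain ⟨B, hB0, hB⟩ := exists_mul_deriv_smoothStep_le
  refine ⟨2 * B, by positivity, fun r t hr ht => ?_⟩
  rcases lt_or_ge t r with h | h
  · rw [cutoffDensity_of_lt_radius d ht h]; positivity
  · rw [cutoffDensity, sq_rpow_neg_div_two d ht, mul_right_comm]
    gcongr 2 * ?_ * ?_
    · exact hB _
    · exact Real.rpow_le_rpow_of_nonpos hr h (neg_nonpos.2 hd)

lemma exists_cutoffDensity_le_one_add_rpow (hd : 0 ≤ d) : ∃ B : ℝ, 0 ≤ B ∧ ∀ r t : ℝ, 1 ≤ r →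
    0 ≤ t → cutoffDensity d r (t ^ 2) ≤ B * (1 + t) ^ (-d) := by
  obtain ⟨B, hB0, hB⟩ := exists_cutoffDensity_le hd
  refine ⟨B * 3 ^ d, by positivity, fun r t hr ht => ?_⟩
  rcases lt_or_ge (2 * r) t with h | h
  · rw [cutoffDensity_of_lt d (by linarith) h]; positivity
  calc cutoffDensity d r (t ^ 2) ≤ B * r ^ (-d) := hB r t (by linarith) ht
    _ ≤ B * ((1 + t) / 3) ^ (-d) := by
        gcongr B * ?_
        exact Real.rpow_le_rpow_of_nonpos (by positivity) (by linarith) (neg_nonpos.2 hd)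
    _ = B * 3 ^ d * (1 + t) ^ (-d) := by
        rw [Real.div_rpow (by positivity) (by norm_num), Real.rpow_neg (by norm_num : (0 : ℝ) ≤ 3)]
        field_simp

lemma measurable_cutoffDensity (d r : ℝ) : Measurable (cutoffDensity d r) := by
  have := continuous_deriv_smoothStep.measurable
  unfold cutoffDensity; fun_prop

lemma integral_Ioi_deriv_smoothStep_comp_sq (hr : 0 < r) :
    ∫ t in Set.Ioi 0, deriv smoothStep (t ^ 2 / r ^ 2) * (2 * t / r ^ 2) = 1 := by
  have hderiv (t : ℝ) : HasDerivAt (fun t : ℝ => smoothStep (t ^ 2 / r ^ 2))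
      (deriv smoothStep (t ^ 2 / r ^ 2) * (2 * t / r ^ 2)) t := by
    refine (differentiable_smoothStep _).hasDerivAt.comp t ?_
    simpa using (hasDerivAt_pow 2 t).div_const (r ^ 2)
  have hlim : Tendsto (fun t : ℝ => smoothStep (t ^ 2 / r ^ 2)) atTop (𝓝 1) := by
    refine tendsto_const_nhds.congr' ?_
    filter_upwards [eventually_ge_atTop (2 * r)] with t ht
    rw [smoothStep_of_two_le (by rw [le_div_iff₀ (by positivity)]; nlinarith)]
  rw [integral_Ioi_of_hasDerivAt_of_nonneg' (fun t _ => hderiv t) (fun t ht => ?_) hlim,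
    smoothStep_of_le_one (by simp), sub_zero]
  have := deriv_smoothStep_nonneg (t ^ 2 / r ^ 2)
  have : 0 < t := ht
  positivity

variable {E : Type*} [NormedAddCommGroup E] [InnerProductSpace ℝ E] [FiniteDimensional ℝ E]
  [MeasurableSpace E] [BorelSpace E]

variable (E) in
/-- The surface area of the unit sphere of a Euclidean space, computed from the volume of the unit
ball. -/
noncomputable def sphereArea : ℝ := finrank ℝ E * volume.real (Metric.ball (0 : E) 1)

lemma volume_real_unitBall_pos : 0 < volume.real (Metric.ball (0 : E) 1) :=
  ENNReal.toReal_pos (Metric.measure_ball_pos _ _ one_pos).ne' measure_ball_lt_top.ne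

variable [Nontrivial E]

lemma sphereArea_pos : 0 < sphereArea E :=
  mul_pos (Nat.cast_pos.2 Module.finrank_pos) volume_real_unitBall_pos

lemma integral_cutoffDensity (hr : 0 < r) :
    ∫ z : E, cutoffDensity (finrank ℝ E) r (‖z‖ ^ 2) = sphereArea E := by
  have hcongr : Set.EqOn
      (fun t : ℝ => t ^ (finrank ℝ E - 1) • cutoffDensity (finrank ℝ E) r (t ^ 2))
      (fun t => deriv smoothStep (t ^ 2 / r ^ 2) * (2 * t / r ^ 2)) (Set.Ioi 0) := by
    intro t (ht : 0 < t)
    have hpow : t ^ finrank ℝ E = t ^ (finrank ℝ E - 1) * t := by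
      rw [← pow_succ, Nat.sub_add_cancel (Module.finrank_pos (R := ℝ) (M := E))]
    simp only [cutoffDensity, sq_rpow_neg_div_two _ ht.le, Real.rpow_neg ht.le, Real.rpow_natCast,
      smul_eq_mul, hpow]
    field_simp
  rw [integral_fun_norm_addHaar volume fun t => cutoffDensity (finrank ℝ E) r (t ^ 2),
    setIntegral_congr_fun measurableSet_Ioi hcongr, integral_Ioi_deriv_smoothStep_comp_sq hr,
    sphereArea, smul_eq_mul, mul_one, nsmul_eq_mul]

end SmoothCutoff

section GreenRepresentation

open scoped ContDiff

variable {E S : Type*} [NormedAddCommGroup E] [InnerProductSpace ℝ E]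
  [NormedAddCommGroup S] [NormedSpace ℝ S] {c : E →L[ℝ] S →L[ℝ] S} {f F : E → S}

/-- The fundamental solution `‖z‖ ^ (-n) c z`, `z = x - y`, of the Dirac operator in dimension `n`,
up to the factor `-sphereArea E`, applied to a spinor `v`. -/
noncomputable def greenKernel (c : E →L[ℝ] S →L[ℝ] S) (x y : E) (v : S) : S :=
  ‖x - y‖ ^ (-finrank ℝ E : ℝ) • c (x - y) v

lemma greenKernel_self (c : E →L[ℝ] S →L[ℝ] S) (x : E) (v : S) : greenKernel c x x v = 0 := by
  simp [greenKernel]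

lemma norm_greenKernel_le (hc : IsCliffordMul c) (x y : E) (v : S) :
    ‖greenKernel c x y v‖ ≤ ‖x - y‖ ^ (-(finrank ℝ E - 1) : ℝ) * ‖v‖ := by
  rcases eq_or_ne x y with rfl | hxy
  · rw [greenKernel_self, norm_zero]
    positivity
  · rw [greenKernel, norm_smul, hc.norm_apply, Real.norm_of_nonneg (by positivity), ← mul_assoc,
      ← Real.rpow_add_one (norm_sub_pos_iff.2 hxy).ne', neg_sub, neg_add_eq_sub]

lemma enorm_greenKernel_le (hc : IsCliffordMul c) (x y : E) (v : S) :
    ‖greenKernel c x y v‖ₑ ≤ rieszKernel (finrank ℝ E - 1) x y * ‖v‖ₑ := by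
  rw [rieszKernel, ← ofReal_norm, ← ofReal_norm v, ← ENNReal.ofReal_mul (by positivity)]
  exact ENNReal.ofReal_le_ofReal (norm_greenKernel_le hc x y v)

lemma cutoffProfile_smul_clifford (c : E →L[ℝ] S →L[ℝ] S) (r : ℝ) (x y : E) (v : S) :
    cutoffProfile (finrank ℝ E) r (‖x - y‖ ^ 2) • c (x - y) v =
      smoothStep (‖x - y‖ ^ 2 / r ^ 2) • greenKernel c x y v := by
  rw [cutoffProfile, greenKernel, sq_rpow_neg_div_two _ (norm_nonneg _), smul_smul, mul_comm]

variable [FiniteDimensional ℝ E] [MeasurableSpace E] [BorelSpace E]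

/-- The convolution of `F` with `greenKernel`, which recovers `sphereArea E • f` from a solution
`f` of `D f + F = 0`. -/
noncomputable def greenPotential (c : E →L[ℝ] S →L[ℝ] S) (F : E → S) (x : E) : S :=
  ∫ y, greenKernel c x y (F y)

lemma aestronglyMeasurable_greenKernel (hF : AEStronglyMeasurable F) (x : E) :
    AEStronglyMeasurable fun y => greenKernel c x y (F y) := by
  have hsub : AEStronglyMeasurable fun y : E => x - y :=
    (continuous_const.sub continuous_id).aestronglyMeasurable
  have hpow : Measurable fun y : E => ‖x - y‖ ^ (-finrank ℝ E : ℝ) := by fun_prop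
  exact hpow.aestronglyMeasurable.smul (c.aestronglyMeasurable_comp₂ hsub hF)

lemma integrable_greenKernel (hc : IsCliffordMul c) (hF : AEStronglyMeasurable F) {x : E}
    (h : ∫⁻ y, rieszKernel (finrank ℝ E - 1) x y * ‖F y‖ₑ < ⊤) :
    Integrable fun y => greenKernel c x y (F y) :=
  ⟨aestronglyMeasurable_greenKernel hF x,
    (lintegral_mono fun y => enorm_greenKernel_le hc x y (F y)).trans_lt h⟩

lemma integrable_cutoffDensity_smul (hf : LocallyIntegrable f) {r : ℝ} (hr : 0 < r) (x : E) :
    Integrable fun y => cutoffDensity (finrank ℝ E) r (‖y - x‖ ^ 2) • f y := by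
  obtain ⟨B, -, hB⟩ := exists_cutoffDensity_le (finrank ℝ E).cast_nonneg
  have hmeas : Measurable fun y : E => cutoffDensity (finrank ℝ E) r (‖y - x‖ ^ 2) :=
    (measurable_cutoffDensity _ r).comp (by fun_prop)
  have hball : IntegrableOn (fun y => cutoffDensity (finrank ℝ E) r (‖y - x‖ ^ 2) • f y)
      (Metric.closedBall x (2 * r)) := by
    refine (hf.integrableOn_isCompact (isCompact_closedBall _ _)).bdd_smul
      (B * r ^ (-finrank ℝ E : ℝ)) hmeas.aestronglyMeasurable (ae_of_all _ fun y => ?_)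
    rw [Real.norm_of_nonneg (cutoffDensity_nonneg _ _ (by positivity))]
    exact hB r _ hr (norm_nonneg _)
  refine (integrableOn_iff_integrable_of_support_subset fun y hy => ?_).1 hball
  contrapose! hy
  rw [Metric.mem_closedBall, dist_eq_norm, not_le] at hy
  simp only [Function.mem_support, cutoffDensity_of_lt _ hr hy, zero_smul, ne_eq, not_true_eq_false,
    not_false_eq_true]

lemma IsWeakDiracSolution.integral_cutoffDensity_sub [CompleteSpace S]
    (h : IsWeakDiracSolution c f F) (hc : IsCliffordMul c) (hf : LocallyIntegrable f)
    (hF : LocallyIntegrable F) {r R : ℝ} (hr : 0 < r) (hrR : r ≤ R) (x : E) :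
    (∫ y, cutoffDensity (finrank ℝ E) r (‖y - x‖ ^ 2) • f y) -
        ∫ y, cutoffDensity (finrank ℝ E) R (‖y - x‖ ^ 2) • f y =
      ∫ y, (smoothStep (‖x - y‖ ^ 2 / r ^ 2) - smoothStep (‖x - y‖ ^ 2 / R ^ 2)) •
        greenKernel c x y (F y) := by
  have hR : 0 < R := hr.trans_le hrR
  have hvanish (s : ℝ) (hs : (2 * R) ^ 2 ≤ s) :
      cutoffProfile (finrank ℝ E) r s - cutoffProfile (finrank ℝ E) R s = 0 := by
    have htwo {ρ : ℝ} (hρ : 0 < ρ) (hρR : ρ ≤ R) : 2 ≤ s / ρ ^ 2 := by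
      rw [le_div_iff₀ (by positivity)]
      nlinarith
    rw [cutoffProfile, cutoffProfile, smoothStep_of_two_le (htwo hr hrR),
      smoothStep_of_two_le (htwo hR le_rfl), sub_self]
  rw [← integral_sub (integrable_cutoffDensity_smul hf hr x)
    (integrable_cutoffDensity_smul hf hR x)]
  convert h.integral_radial_smul hc hf hF ((contDiff_cutoffProfile (finrank ℝ E) r).sub
    (contDiff_cutoffProfile (finrank ℝ E) R)) hvanish x using 2
  · ext1 y
    have hdiff (ρ : ℝ) : DifferentiableAt ℝ (cutoffProfile (finrank ℝ E) ρ) (‖y - x‖ ^ 2) :=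
      ((contDiff_cutoffProfile _ ρ).differentiable (by simp)) _
    rw [← sub_smul, ← two_mul_deriv_cutoffProfile_add, ← two_mul_deriv_cutoffProfile_add,
      deriv_fun_sub (hdiff r) (hdiff R)]
    congr 1
    ring
  · ext1 y
    rw [sub_smul, sub_smul, cutoffProfile_smul_clifford, cutoffProfile_smul_clifford]

lemma tendsto_integral_smoothStep_sub_smul_greenKernel {x : E}
    (h : Integrable fun y => greenKernel c x y (F y)) :
    Tendsto (fun r : ℝ => ∫ y, (smoothStep (‖x - y‖ ^ 2 / r ^ 2) -
        smoothStep (‖x - y‖ ^ 2 / r⁻¹ ^ 2)) • greenKernel c x y (F y))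
      (𝓝[>] 0) (𝓝 (greenPotential c F x)) := by
  refine tendsto_integral_filter_of_dominated_convergence (fun y => ‖greenKernel c x y (F y)‖)
    (.of_forall fun r => ?_) (.of_forall fun r => ae_of_all _ fun y => ?_) h.norm
    (ae_of_all _ fun y => ?_)
  · have := (contDiff_smoothStep.continuous).measurable
    exact (by fun_prop : Measurable fun y : E => smoothStep (‖x - y‖ ^ 2 / r ^ 2) -
      smoothStep (‖x - y‖ ^ 2 / r⁻¹ ^ 2)).aestronglyMeasurable.smul h.1
  · rw [norm_smul]
    exact mul_le_of_le_one_left (norm_nonneg _) (abs_smoothStep_sub_smoothStep_le _ _)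
  · rcases eq_or_ne x y with rfl | hxy
    · simp [greenKernel_self]
    have hpos : 0 < ‖x - y‖ := norm_sub_pos_iff.2 hxy
    refine tendsto_const_nhds.congr' ?_
    filter_upwards [self_mem_nhdsWithin, eventually_nhdsWithin_of_eventually_nhds
      (eventually_le_nhds (half_pos hpos)), eventually_nhdsWithin_of_eventually_nhds
      (eventually_le_nhds (inv_pos.2 hpos))] with r (hr : 0 < r) hr2 hrinv
    have hinner : 2 ≤ ‖x - y‖ ^ 2 / r ^ 2 := by
      rw [le_div_iff₀ (by positivity)]
      nlinarith
    have houter : ‖x - y‖ ^ 2 / r⁻¹ ^ 2 ≤ 1 := by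
      refine div_le_one_of_le₀ ?_ (by positivity)
      gcongr
      exact le_inv_of_le_inv₀ hr hrinv
    rw [smoothStep_of_two_le hinner, smoothStep_of_le_one houter, sub_zero, one_smul]

lemma tendsto_integral_cutoffDensity_atTop [Nontrivial E] (hf : MemLp f 2) (x : E) :
    Tendsto (fun r : ℝ => ∫ y, cutoffDensity (finrank ℝ E) r (‖y - x‖ ^ 2) • f y)
      atTop (𝓝 0) := by
  obtain ⟨B, -, hB⟩ := exists_cutoffDensity_le_one_add_rpow (finrank ℝ E).cast_nonneg
  have hweight : MemLp (fun y : E => (1 + ‖y - x‖) ^ (-finrank ℝ E : ℝ)) 2 := by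
    rw [memLp_two_iff_integrable_sq (Measurable.aestronglyMeasurable (by fun_prop))]
    have hpos : (0 : ℝ) < finrank ℝ E := Nat.cast_pos.2 Module.finrank_pos
    have hint : Integrable fun z : E => (1 + ‖z‖) ^ (-(finrank ℝ E * 2 : ℝ)) :=
      integrable_one_add_norm (by linarith)
    refine (hint.comp_sub_right x).congr (ae_of_all _ fun y => ?_)
    simp only
    rw [← Real.rpow_mul_natCast (by positivity), Nat.cast_ofNat, neg_mul]
  rw [← integral_zero E S]
  refine tendsto_integral_filter_of_dominated_convergence
    (fun y => B * ((1 + ‖y - x‖) ^ (-finrank ℝ E : ℝ) * ‖f y‖)) (.of_forall fun r => ?_) ?_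
    ((hweight.integrable_mul hf.norm).const_mul B) (ae_of_all _ fun y => ?_)
  · exact ((measurable_cutoffDensity _ r).comp (by fun_prop)).aestronglyMeasurable.smul hf.1
  · filter_upwards [eventually_ge_atTop 1] with r hr
    refine ae_of_all _ fun y => ?_
    rw [norm_smul, Real.norm_of_nonneg (cutoffDensity_nonneg _ _ (by positivity)), ← mul_assoc]
    gcongr
    exact hB r _ hr (norm_nonneg _)
  · refine tendsto_const_nhds.congr' ?_
    filter_upwards [eventually_gt_atTop ‖y - x‖] with r hr
    rw [cutoffDensity_of_lt_radius _ (norm_nonneg _) hr, zero_smul]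

variable [Nontrivial E]

lemma exists_norm_integral_cutoffDensity_sub_le [CompleteSpace S] :
    ∃ C : ℝ, ∀ f : E → S, LocallyIntegrable f → ∀ r : ℝ, 0 < r → ∀ x,
      ‖(∫ y, cutoffDensity (finrank ℝ E) r (‖y - x‖ ^ 2) • f y) - sphereArea E • f x‖ ≤
        C * ⨍ y in Metric.closedBall x (2 * r), ‖f y - f x‖ := by
  obtain ⟨B, -, hB⟩ := exists_cutoffDensity_le (finrank ℝ E).cast_nonneg
  set κ : ℝ := volume.real (Metric.ball (0 : E) 1)
  have hκ : κ ≠ 0 := volume_real_unitBall_pos.ne'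
  refine ⟨B * 2 ^ finrank ℝ E * κ, fun f hf r hr x => ?_⟩
  have hball : volume.real (Metric.closedBall x (2 * r)) = (2 * r) ^ finrank ℝ E * κ :=
    Measure.addHaar_real_closedBall _ _ (by positivity)
  have hsub : LocallyIntegrable fun y => f y - f x := hf.sub (locallyIntegrable_const _)
  have hconst : ∫ y, cutoffDensity (finrank ℝ E) r (‖y - x‖ ^ 2) • f x = sphereArea E • f x := by
    rw [integral_smul_const, integral_sub_right_eq_self
      (fun z : E => cutoffDensity (finrank ℝ E) r (‖z‖ ^ 2)) x, integral_cutoffDensity hr]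
  rw [← hconst, ← integral_sub (integrable_cutoffDensity_smul hf hr x)
    (integrable_cutoffDensity_smul (locallyIntegrable_const _) hr x)]
  simp only [← smul_sub]
  rw [← setIntegral_eq_integral_of_forall_compl_eq_zero (s := Metric.closedBall x (2 * r))
    fun y hy => by
      rw [Metric.mem_closedBall, dist_eq_norm, not_le] at hy
      rw [cutoffDensity_of_lt _ hr hy, zero_smul]]
  calc ‖∫ y in Metric.closedBall x (2 * r),
          cutoffDensity (finrank ℝ E) r (‖y - x‖ ^ 2) • (f y - f x)‖
      ≤ ∫ y in Metric.closedBall x (2 * r), B * r ^ (-finrank ℝ E : ℝ) * ‖f y - f x‖ := by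
        refine norm_integral_le_of_norm_le ((hsub.integrableOn_isCompact
          (isCompact_closedBall _ _)).norm.const_mul _) (ae_of_all _ fun y => ?_)
        rw [norm_smul, Real.norm_of_nonneg (cutoffDensity_nonneg _ r (by positivity))]
        gcongr
        exact hB r _ hr (norm_nonneg _)
    _ = B * 2 ^ finrank ℝ E * κ * ⨍ y in Metric.closedBall x (2 * r), ‖f y - f x‖ := by
        rw [integral_const_mul, setAverage_eq, hball, smul_eq_mul, Real.rpow_neg hr.le,
          Real.rpow_natCast, mul_pow]
        field_simp

lemma ae_tendsto_integral_cutoffDensity [CompleteSpace S] (hf : LocallyIntegrable f) :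
    ∀ᵐ x, Tendsto (fun r : ℝ => ∫ y, cutoffDensity (finrank ℝ E) r (‖y - x‖ ^ 2) • f y) (𝓝[>] 0)
      (𝓝 (sphereArea E • f x)) := by
  obtain ⟨C, hC⟩ := exists_norm_integral_cutoffDensity_sub_le (E := E) (S := S)
  have hradius : Tendsto (fun r : ℝ => 2 * r) (𝓝[>] 0) (𝓝[>] 0) := by
    refine tendsto_nhdsWithin_iff.2 ⟨((continuous_const_mul (2 : ℝ)).tendsto' 0 0
      (mul_zero 2)).mono_left nhdsWithin_le_nhds, ?_⟩
    filter_upwards [self_mem_nhdsWithin] with r (hr : 0 < r) using mul_pos two_pos hr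
  filter_upwards [IsUnifLocDoublingMeasure.ae_tendsto_average_norm_sub volume hf 1] with x hx
  have haverage := hx (l := 𝓝[>] 0) (fun _ : ℝ => x) (fun r => 2 * r) hradius (by
    filter_upwards [self_mem_nhdsWithin] with r (hr : 0 < r)
    exact Metric.mem_closedBall_self (by positivity))
  rw [tendsto_iff_norm_sub_tendsto_zero]
  refine squeeze_zero' (.of_forall fun _ => norm_nonneg _) ?_ (by simpa using haverage.const_mul C)
  filter_upwards [self_mem_nhdsWithin] with r hr using hC f hf r hr x

lemma IsWeakDiracSolution.ae_sphereArea_smul_eq_greenPotential [CompleteSpace S]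
    (h : IsWeakDiracSolution c f F) (hc : IsCliffordMul c) (hf : MemLp f 2)
    (hF : LocallyIntegrable F)
    (hfin : ∀ᵐ x, ∫⁻ y, rieszKernel (finrank ℝ E - 1) x y * ‖F y‖ₑ < ⊤) :
    ∀ᵐ x, sphereArea E • f x = greenPotential c F x := by
  have hloc := hf.locallyIntegrable (by norm_num)
  filter_upwards [ae_tendsto_integral_cutoffDensity hloc, hfin] with x hinner hx
  have houter := (tendsto_integral_cutoffDensity_atTop hf x).comp tendsto_inv_nhdsGT_zero
  have hkernel := tendsto_integral_smoothStep_sub_smul_greenKernel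
    (integrable_greenKernel hc hF.aestronglyMeasurable hx)
  refine tendsto_nhds_unique (by simpa using hinner.sub houter) (hkernel.congr' ?_)
  filter_upwards [self_mem_nhdsWithin, eventually_nhdsWithin_of_eventually_nhds
    (eventually_le_nhds one_pos)] with r (hr : 0 < r) hr1
  exact (h.integral_cutoffDensity_sub hc hloc hF hr
    (hr1.trans ((one_le_inv₀ hr).2 hr1)) x).symm

end GreenRepresentation

section GreenPotential

variable {E S : Type*} [NormedAddCommGroup E] {F : E → S} {ω : E}

lemma norm_smul_of_norm_eq_one [NormedSpace ℝ E] (hω : ‖ω‖ = 1) {r : ℝ} (hr : 0 ≤ r) :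
    ‖r • ω‖ = r := by
  rw [norm_smul, hω, mul_one, Real.norm_of_nonneg hr]

variable [InnerProductSpace ℝ E] [NormedAddCommGroup S]

section Kernel

variable [NormedSpace ℝ S]

lemma enorm_sub_smoothStep_smul_le (s : ℝ) (v : S) : ‖v - smoothStep s • v‖ₑ ≤ ‖v‖ₑ := by
  have hsmul : v - smoothStep s • v = (1 - smoothStep s) • v := by rw [sub_smul, one_smul]
  rw [hsmul, enorm_smul]
  refine mul_le_of_le_one_left' ?_
  rw [← ofReal_norm, ENNReal.ofReal_le_one]
  simpa only [smoothStep_of_two_le le_rfl, Real.norm_eq_abs] using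
    abs_smoothStep_sub_smoothStep_le 2 s

variable {c : E →L[ℝ] S →L[ℝ] S}

lemma tendsto_rpow_smul_greenKernel (c : E →L[ℝ] S →L[ℝ] S) (hω : ‖ω‖ = 1) (y : E) (v : S) :
    Tendsto (fun r : ℝ => r ^ (finrank ℝ E - 1 : ℝ) • greenKernel c (r • ω) y v) atTop
      (𝓝 (c ω v)) := by
  have hdir : Tendsto (fun r : ℝ => ω - r⁻¹ • y) atTop (𝓝 ω) := by
    have hzero : Tendsto (fun r : ℝ => r⁻¹ • y) atTop (𝓝 ((0 : ℝ) • y)) :=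
      tendsto_inv_atTop_zero.smul_const y
    simpa using hzero.const_sub ω
  have hlim : Tendsto (fun r : ℝ => ‖ω - r⁻¹ • y‖ ^ (-finrank ℝ E : ℝ) • c (ω - r⁻¹ • y) v) atTop
      (𝓝 (‖ω‖ ^ (-finrank ℝ E : ℝ) • c ω v)) :=
    (hdir.norm.rpow_const (Or.inl (by simp [hω]))).smul
      (((c.flip v).continuous.tendsto _).comp hdir)
  rw [hω, Real.one_rpow, one_smul] at hlim
  refine hlim.congr' ?_
  filter_upwards [eventually_gt_atTop 0] with r hr
  have hscale : r • ω - y = r • (ω - r⁻¹ • y) := by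
    rw [smul_sub, smul_smul, mul_inv_cancel₀ hr.ne', one_smul]
  have hpow : r ^ (finrank ℝ E - 1 : ℝ) * r ^ (-finrank ℝ E : ℝ) * r = 1 := by
    rw [← Real.rpow_add hr, ← Real.rpow_add_one hr.ne', ← sub_eq_add_neg, sub_sub_cancel_left,
      neg_add_cancel, Real.rpow_zero]
  rw [greenKernel, hscale, norm_smul, Real.norm_of_nonneg hr.le,
    Real.mul_rpow hr.le (norm_nonneg _), map_smul, smul_apply, smul_smul, smul_smul]
  congr 1
  linear_combination -‖ω - r⁻¹ • y‖ ^ (-finrank ℝ E : ℝ) * hpow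

lemma norm_smoothStep_smul_greenKernel_le [FiniteDimensional ℝ E] [Nontrivial E]
    (hc : IsCliffordMul c) {r : ℝ} (hr : 0 < r) (x y : E) (v : S) :
    ‖smoothStep (‖x - y‖ ^ 2 / r ^ 2) • greenKernel c x y v‖ ≤
      r ^ (-(finrank ℝ E - 1) : ℝ) * ‖v‖ := by
  rw [norm_smul]
  rcases lt_or_ge ‖x - y‖ r with h | h
  · rw [smoothStep_of_le_one (div_le_one_of_le₀ (by gcongr) (by positivity)), norm_zero, zero_mul]
    positivity
  · calc ‖smoothStep (‖x - y‖ ^ 2 / r ^ 2)‖ * ‖greenKernel c x y v‖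
        ≤ 1 * (‖x - y‖ ^ (-(finrank ℝ E - 1) : ℝ) * ‖v‖) := by
          gcongr
          · exact norm_smoothStep_le_one _
          · exact norm_greenKernel_le hc x y v
      _ ≤ r ^ (-(finrank ℝ E - 1) : ℝ) * ‖v‖ := by
          rw [one_mul]
          gcongr ?_ * _
          exact Real.rpow_le_rpow_of_nonpos hr h
            (neg_nonpos.2 (sub_nonneg.2 (Nat.one_le_cast.2 Module.finrank_pos)))

lemma norm_rpow_smul_greenKernel_le [FiniteDimensional ℝ E] [Nontrivial E] (hc : IsCliffordMul c)
    {r : ℝ} (hr : 0 < r) {x y : E} (hxy : r / 2 ≤ ‖x - y‖) (v : S) :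
    ‖r ^ (finrank ℝ E - 1 : ℝ) • greenKernel c x y v‖ ≤ 2 ^ (finrank ℝ E - 1 : ℝ) * ‖v‖ := by
  have hn : (1 : ℝ) ≤ finrank ℝ E := Nat.one_le_cast.2 Module.finrank_pos
  calc ‖r ^ (finrank ℝ E - 1 : ℝ) • greenKernel c x y v‖
      ≤ r ^ (finrank ℝ E - 1 : ℝ) * ((r / 2) ^ (-(finrank ℝ E - 1) : ℝ) * ‖v‖) := by
        rw [norm_smul, Real.norm_of_nonneg (by positivity)]
        gcongr
        refine (norm_greenKernel_le hc x y v).trans ?_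
        gcongr ?_ * _
        exact Real.rpow_le_rpow_of_nonpos (by positivity) hxy (by linarith)
    _ = 2 ^ (finrank ℝ E - 1 : ℝ) * ‖v‖ := by
        rw [← mul_assoc, Real.rpow_neg (by positivity), Real.div_rpow hr.le zero_le_two, inv_div,
          mul_div_cancel₀ _ (by positivity)]

end Kernel

variable [FiniteDimensional ℝ E] [MeasurableSpace E] [BorelSpace E] {C : ℝ≥0} {b : ℝ}

lemma integrable_of_enorm_le_decayWeight (hF : AEStronglyMeasurable F) (hb : finrank ℝ E < b)
    (hC : ∀ᵐ y, ‖F y‖ₑ ≤ C * decayWeight b y) : Integrable F := by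
  refine ⟨hF, ?_⟩
  calc ∫⁻ y, ‖F y‖ₑ ≤ ∫⁻ y, C * decayWeight b y := lintegral_mono_ae hC
    _ = C * ∫⁻ y, decayWeight b y := lintegral_const_mul' _ _ ENNReal.coe_ne_top
    _ < ∞ := ENNReal.mul_lt_top ENNReal.coe_lt_top (lintegral_decayWeight_lt_top volume hb)

lemma lintegral_rieszKernel_mul_enorm_lt_top [Nontrivial E] (hb : finrank ℝ E < b)
    (hC : ∀ᵐ y, ‖F y‖ₑ ≤ C * decayWeight b y) (x : E) :
    ∫⁻ y, rieszKernel (finrank ℝ E - 1) x y * ‖F y‖ₑ < ∞ := by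
  have hn : (1 : ℝ) ≤ finrank ℝ E := Nat.one_le_cast.2 Module.finrank_pos
  obtain ⟨M, hM⟩ := exists_lintegral_rieszKernel_mul_decayWeight_le (E := E) volume
    (a := finrank ℝ E - 1) (b := b) le_rfl (by linarith) (by linarith) (by linarith)
  calc ∫⁻ y, rieszKernel (finrank ℝ E - 1) x y * ‖F y‖ₑ
      ≤ ∫⁻ y, C * (rieszKernel (finrank ℝ E - 1) x y * decayWeight b y) := by
        refine lintegral_mono_ae ?_
        filter_upwards [hC] with y hy
        rw [mul_left_comm]
        gcongr
    _ = C * ∫⁻ y, rieszKernel (finrank ℝ E - 1) x y * decayWeight b y :=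
        lintegral_const_mul' _ _ ENNReal.coe_ne_top
    _ < ∞ := ENNReal.mul_lt_top ENNReal.coe_lt_top ((hM x).trans_lt
        (ENNReal.mul_lt_top ENNReal.coe_lt_top (decayWeight_ne_top 0 x).lt_top))

variable [NormedSpace ℝ S] [Nontrivial E] {c : E →L[ℝ] S →L[ℝ] S}

lemma continuous_integral_smoothStep_smul_greenKernel (hc : IsCliffordMul c)
    (hF : Integrable F) {r : ℝ} (hr : 0 < r) :
    Continuous fun x => ∫ y, smoothStep (‖x - y‖ ^ 2 / r ^ 2) • greenKernel c x y (F y) := by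
  refine continuous_of_dominated (fun x => ?_)
    (fun x => ae_of_all _ fun y => norm_smoothStep_smul_greenKernel_le hc hr x y (F y))
    (hF.norm.const_mul _) (ae_of_all _ fun y => ?_)
  · have := contDiff_smoothStep.continuous.measurable
    exact (by fun_prop : Measurable fun y : E =>
      smoothStep (‖x - y‖ ^ 2 / r ^ 2)).aestronglyMeasurable.smul
      (aestronglyMeasurable_greenKernel hF.1 x)
  · simp only [← cutoffProfile_smul_clifford]
    have hcliff : Continuous fun x : E => c (x - y) (F y) :=
      (c.flip (F y)).continuous.comp (continuous_id.sub continuous_const)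
    exact ((contDiff_cutoffProfile _ r).continuous.comp (by fun_prop)).smul hcliff

lemma exists_enorm_greenPotential_sub_le (hc : IsCliffordMul c) (hF : AEStronglyMeasurable F)
    (hb : finrank ℝ E < b) (hC : ∀ᵐ y, ‖F y‖ₑ ≤ C * decayWeight b y) :
    ∃ M : ℝ≥0, ∀ r : ℝ, 0 < r → ∀ x, ‖greenPotential c F x -
      ∫ y, smoothStep (‖x - y‖ ^ 2 / r ^ 2) • greenKernel c x y (F y)‖ₑ ≤
        M * ENNReal.ofReal (2 * r) := by
  obtain ⟨κ, hκ⟩ := exists_lintegral_ball_rieszKernel_eq (E := E) volume (sub_one_lt _)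
  refine ⟨C * κ, fun r hr x => ?_⟩
  have hint := integrable_greenKernel hc hF (lintegral_rieszKernel_mul_enorm_lt_top hb hC x)
  have hmeas : Measurable fun y : E => smoothStep (‖x - y‖ ^ 2 / r ^ 2) :=
    contDiff_smoothStep.continuous.measurable.comp (by fun_prop)
  have hint' : Integrable fun y => smoothStep (‖x - y‖ ^ 2 / r ^ 2) • greenKernel c x y (F y) :=
    hint.bdd_smul 1 hmeas.aestronglyMeasurable (ae_of_all _ fun y => norm_smoothStep_le_one _)
  rw [greenPotential, ← integral_sub hint hint']
  refine (enorm_integral_le_lintegral_enorm _).trans ?_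
  calc ∫⁻ y, ‖greenKernel c x y (F y) -
          smoothStep (‖x - y‖ ^ 2 / r ^ 2) • greenKernel c x y (F y)‖ₑ
      ≤ ∫⁻ y, (Metric.ball x (2 * r)).indicator
          (fun y => C * rieszKernel (finrank ℝ E - 1) x y) y := by
        refine lintegral_mono_ae ?_
        filter_upwards [hC] with y hy
        by_cases hyb : y ∈ Metric.ball x (2 * r)
        · rw [Set.indicator_of_mem hyb]
          refine (enorm_sub_smoothStep_smul_le _ _).trans ((enorm_greenKernel_le hc x y _).trans ?_)
          rw [mul_comm]
          gcongr
          exact hy.trans (mul_le_of_le_one_right'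
            (decayWeight_le_one ((Nat.cast_nonneg _).trans hb.le) y))
        · rw [Metric.mem_ball', dist_eq_norm, not_lt] at hyb
          rw [smoothStep_of_two_le (by rw [le_div_iff₀ (by positivity)]; nlinarith), one_smul,
            sub_self, enorm_zero]
          exact zero_le
    _ = C * κ * ENNReal.ofReal (2 * r) := by
        rw [lintegral_indicator measurableSet_ball, lintegral_const_mul' _ _ ENNReal.coe_ne_top,
          hκ x (by positivity), sub_sub_cancel, Real.rpow_one, mul_assoc]

lemma continuous_greenPotential (hc : IsCliffordMul c) (hF : AEStronglyMeasurable F)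
    (hb : finrank ℝ E < b) (hC : ∀ᵐ y, ‖F y‖ₑ ≤ C * decayWeight b y) :
    Continuous (greenPotential c F) := by
  obtain ⟨M, hM⟩ := exists_enorm_greenPotential_sub_le hc hF hb hC
  have hlim : Tendsto (fun r : ℝ => M * ENNReal.ofReal (2 * r)) (𝓝[>] 0) (𝓝 0) := by
    have hcont : Continuous fun r : ℝ => M * ENNReal.ofReal (2 * r) :=
      (ENNReal.continuous_const_mul ENNReal.coe_ne_top).comp
        (ENNReal.continuous_ofReal.comp (by fun_prop))
    exact (hcont.tendsto' 0 0 (by simp)).mono_left nhdsWithin_le_nhds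
  have hunif : TendstoUniformly
      (fun (r : ℝ) x => ∫ y, smoothStep (‖x - y‖ ^ 2 / r ^ 2) • greenKernel c x y (F y))
      (greenPotential c F) (𝓝[>] 0) := by
    rw [EMetric.tendstoUniformly_iff]
    intro ε hε
    filter_upwards [hlim.eventually_lt_const hε, self_mem_nhdsWithin] with r hrε hr x
    rw [edist_eq_enorm_sub]
    exact (hM r hr x).trans_lt hrε
  refine hunif.continuous (Eventually.frequently ?_)
  filter_upwards [self_mem_nhdsWithin] with r hr
  exact continuous_integral_smoothStep_smul_greenKernel hc
    (integrable_of_enorm_le_decayWeight hF hb hC) hr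

lemma exists_norm_setIntegral_greenKernel_le (hc : IsCliffordMul c) (hb : 0 ≤ b)
    (hC : ∀ᵐ y, ‖F y‖ₑ ≤ C * decayWeight b y) :
    ∃ M : ℝ≥0, ∀ x : E, ‖∫ y in Metric.ball x ((1 + ‖x‖) / 2), greenKernel c x y (F y)‖ ≤
      M * (1 + ‖x‖) ^ (-(b - 1)) := by
  obtain ⟨M, hM⟩ := exists_lintegral_ball_rieszKernel_mul_decayWeight_le (E := E) volume
    (sub_one_lt (finrank ℝ E : ℝ)) hb
  refine ⟨C * M, fun x => ?_⟩
  rw [← ENNReal.ofReal_le_ofReal_iff (by positivity), ofReal_norm]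
  calc ‖∫ y in Metric.ball x ((1 + ‖x‖) / 2), greenKernel c x y (F y)‖ₑ
      ≤ ∫⁻ y in Metric.ball x ((1 + ‖x‖) / 2),
          C * (rieszKernel (finrank ℝ E - 1) x y * decayWeight b y) := by
        refine (enorm_integral_le_lintegral_enorm _).trans (lintegral_mono_ae ?_)
        filter_upwards [ae_restrict_of_ae hC] with y hy
        refine (enorm_greenKernel_le hc x y (F y)).trans ?_
        rw [mul_left_comm]
        gcongr
    _ ≤ C * (M * decayWeight (finrank ℝ E - 1 + b - finrank ℝ E) x) := by
        rw [lintegral_const_mul' _ _ ENNReal.coe_ne_top]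
        gcongr
        exact hM x
    _ = ENNReal.ofReal ((C * M : ℝ≥0) * (1 + ‖x‖) ^ (-(b - 1))) := by
        rw [ENNReal.ofReal_mul NNReal.zero_le_coe, ENNReal.ofReal_coe_nnreal, ENNReal.coe_mul,
          mul_assoc, decayWeight]
        congr 5
        ring

lemma tendsto_rpow_smul_setIntegral_ball_greenKernel (hc : IsCliffordMul c) (hb : finrank ℝ E < b)
    (hC : ∀ᵐ y, ‖F y‖ₑ ≤ C * decayWeight b y) (hω : ‖ω‖ = 1) :
    Tendsto (fun r : ℝ => r ^ (finrank ℝ E - 1 : ℝ) •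
      ∫ y in Metric.ball (r • ω) ((1 + ‖r • ω‖) / 2), greenKernel c (r • ω) y (F y)) atTop
      (𝓝 0) := by
  have hn : (1 : ℝ) ≤ finrank ℝ E := Nat.one_le_cast.2 Module.finrank_pos
  obtain ⟨M, hM⟩ := exists_norm_setIntegral_greenKernel_le hc (by linarith) hC
  have hlim : Tendsto (fun r : ℝ => M * (1 + r) ^ (-(b - finrank ℝ E))) atTop (𝓝 0) := by
    simpa using ((tendsto_rpow_neg_atTop (sub_pos.2 hb)).comp
      (tendsto_atTop_add_const_left _ (1 : ℝ) tendsto_id)).const_mul (M : ℝ)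
  refine squeeze_zero_norm' ?_ hlim
  filter_upwards [eventually_gt_atTop 0] with r hr
  rw [norm_smul, Real.norm_of_nonneg (by positivity)]
  calc r ^ (finrank ℝ E - 1 : ℝ) *
        ‖∫ y in Metric.ball (r • ω) ((1 + ‖r • ω‖) / 2), greenKernel c (r • ω) y (F y)‖
      ≤ (1 + r) ^ (finrank ℝ E - 1 : ℝ) * (M * (1 + r) ^ (-(b - 1))) := by
        gcongr
        · linarith
        · exact (hM (r • ω)).trans_eq (by rw [norm_smul_of_norm_eq_one hω hr.le])
    _ = M * (1 + r) ^ (-(b - finrank ℝ E)) := by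
        rw [mul_left_comm, ← Real.rpow_add (by positivity)]
        congr 2
        ring

lemma tendsto_integral_indicator_rpow_smul_greenKernel (hc : IsCliffordMul c) (hF : Integrable F)
    (hω : ‖ω‖ = 1) :
    Tendsto (fun r : ℝ => ∫ y, (Metric.ball (r • ω) ((1 + ‖r • ω‖) / 2))ᶜ.indicator
      (fun y => r ^ (finrank ℝ E - 1 : ℝ) • greenKernel c (r • ω) y (F y)) y) atTop
      (𝓝 (∫ y, c ω (F y))) := by
  refine tendsto_integral_filter_of_dominated_convergence
    (fun y => 2 ^ (finrank ℝ E - 1 : ℝ) * ‖F y‖) (.of_forall fun r => ?_) ?_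
    (hF.norm.const_mul _) (ae_of_all _ fun y => ?_)
  · exact ((aestronglyMeasurable_greenKernel hF.1 (r • ω)).const_smul _).indicator
      measurableSet_ball.compl
  · filter_upwards [eventually_gt_atTop 0] with r hr
    refine ae_of_all _ fun y => ?_
    by_cases hy : y ∈ (Metric.ball (r • ω) ((1 + ‖r • ω‖) / 2))ᶜ
    · rw [Set.indicator_of_mem hy]
      rw [Set.mem_compl_iff, Metric.mem_ball', dist_eq_norm, not_lt,
        norm_smul_of_norm_eq_one hω hr.le] at hy
      exact norm_rpow_smul_greenKernel_le hc hr (by linarith) (F y)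
    · rw [Set.indicator_of_notMem hy, norm_zero]
      positivity
  · refine (tendsto_rpow_smul_greenKernel c hω y (F y)).congr' ?_
    filter_upwards [eventually_ge_atTop (1 + 2 * ‖y‖), eventually_gt_atTop 0] with r hry hr
    rw [Set.indicator_of_mem]
    rw [Set.mem_compl_iff, Metric.mem_ball', dist_eq_norm, not_lt]
    have := norm_sub_norm_le (r • ω) y
    rw [norm_smul_of_norm_eq_one hω hr.le] at this ⊢
    linarith

lemma tendsto_rpow_smul_greenPotential [CompleteSpace S] (hc : IsCliffordMul c)
    (hF : AEStronglyMeasurable F) (hb : finrank ℝ E < b)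
    (hC : ∀ᵐ y, ‖F y‖ₑ ≤ C * decayWeight b y) (hω : ‖ω‖ = 1) :
    Tendsto (fun r : ℝ => r ^ (finrank ℝ E - 1 : ℝ) • greenPotential c F (r • ω)) atTop
      (𝓝 (c ω (∫ y, F y))) := by
  have hFi := integrable_of_enorm_le_decayWeight hF hb hC
  have hsum := (tendsto_rpow_smul_setIntegral_ball_greenKernel hc hb hC hω).add
    (tendsto_integral_indicator_rpow_smul_greenKernel hc hFi hω)
  rw [zero_add, (c ω).integral_comp_comm hFi] at hsum
  refine hsum.congr fun r => ?_
  have hint := integrable_greenKernel hc hF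
    (lintegral_rieszKernel_mul_enorm_lt_top hb hC (r • ω))
  rw [integral_indicator measurableSet_ball.compl, integral_smul, ← smul_add,
    integral_add_compl measurableSet_ball hint, greenPotential]

end GreenPotential

section DecayingSolutions

variable {E S : Type*} [NormedAddCommGroup E] [NormedAddCommGroup S] {f F : E → S} {K : ℝ≥0}
  {a ρ : ℝ}

lemma enorm_le_mul_decayWeight_mul_enorm {C : ℝ} {y : E} {s t : S}
    (h : ‖t‖ ≤ C * (1 + ‖y‖) ^ (-ρ) * ‖s‖) :
    ‖t‖ₑ ≤ C.toNNReal * (decayWeight ρ y * ‖s‖ₑ) := by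
  rw [decayWeight, ← ofReal_norm s, ← ENNReal.ofReal_mul (by positivity), ← ofReal_norm t,
    ENNReal.ofNNReal_toNNReal, ← ENNReal.ofReal_mul' (by positivity), ← mul_assoc]
  exact ENNReal.ofReal_le_ofReal h

variable [InnerProductSpace ℝ E] [FiniteDimensional ℝ E] [MeasurableSpace E] [BorelSpace E]

lemma lintegral_rieszKernel_mul_enorm_le (hK : ∀ᵐ y, ‖F y‖ₑ ≤ K * (decayWeight ρ y * ‖f y‖ₑ))
    (x : E) : ∫⁻ y, rieszKernel a x y * ‖F y‖ₑ ≤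
      K * ∫⁻ y, rieszKernel a x y * (decayWeight ρ y * ‖f y‖ₑ) := by
  rw [← lintegral_const_mul' _ _ ENNReal.coe_ne_top]
  refine lintegral_mono_ae ?_
  filter_upwards [hK] with y hy
  rw [mul_left_comm]
  gcongr

lemma lintegral_enorm_sq_lt_top (hf : MemLp f 2) : ∫⁻ x, ‖f x‖ₑ ^ 2 < ∞ := by
  simpa using lintegral_rpow_enorm_lt_top_of_eLpNorm_lt_top two_ne_zero ENNReal.ofNat_ne_top hf.2

variable [NormedSpace ℝ S]

lemma locallyIntegrable_of_enorm_le (hρ : 0 ≤ ρ) (hf : LocallyIntegrable f)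
    (hF : AEStronglyMeasurable F) (hK : ∀ᵐ y, ‖F y‖ₑ ≤ K * (decayWeight ρ y * ‖f y‖ₑ)) :
    LocallyIntegrable F := by
  refine (hf.smul (K : ℝ)).mono hF ?_
  filter_upwards [hK] with y hy
  rw [← enorm_le_iff_norm_le, Pi.smul_apply, enorm_smul, Real.enorm_of_nonneg K.coe_nonneg,
    ENNReal.ofReal_coe_nnreal]
  exact hy.trans (by gcongr; exact mul_le_of_le_one_left' (decayWeight_le_one hρ y))

namespace IsWeakDiracSolution

variable [Nontrivial E] [CompleteSpace S] {c : E →L[ℝ] S →L[ℝ] S}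

lemma ae_sphereArea_smul_eq_greenPotential_of_finrank_le_three (h : IsWeakDiracSolution c f F)
    (hc : IsCliffordMul c) (hE : finrank ℝ E ≤ 3) (hρ : 1 < ρ) (hf : MemLp f 2)
    (hF : AEStronglyMeasurable F) (hK : ∀ᵐ y, ‖F y‖ₑ ≤ K * (decayWeight ρ y * ‖f y‖ₑ)) :
    ∀ᵐ x, sphereArea E • f x = greenPotential c F x := by
  have hn : (1 : ℝ) ≤ finrank ℝ E := Nat.one_le_cast.2 Module.finrank_pos
  have hn3 : (finrank ℝ E : ℝ) ≤ 3 := by exact_mod_cast hE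
  refine h.ae_sphereArea_smul_eq_greenPotential hc hf (locallyIntegrable_of_enorm_le (by linarith)
    (hf.locallyIntegrable one_le_two) hF hK) ?_
  filter_upwards [ae_lintegral_rieszKernel_mul_lt_top (μ := volume) (a := finrank ℝ E - 1)
    (by linarith) (by linarith) (by linarith) hf.1.enorm (lintegral_enorm_sq_lt_top hf)] with x hx
  exact (lintegral_rieszKernel_mul_enorm_le hK x).trans_lt
    (ENNReal.mul_lt_top ENNReal.coe_lt_top hx)

lemma exists_ae_enorm_le_decayWeight (h : IsWeakDiracSolution c f F) (hc : IsCliffordMul c)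
    (hE : finrank ℝ E ≤ 3) (hρ : 1 < ρ) (hf : MemLp f 2) (hF : AEStronglyMeasurable F)
    (hK : ∀ᵐ y, ‖F y‖ₑ ≤ K * (decayWeight ρ y * ‖f y‖ₑ)) :
    ∃ C : ℝ≥0, ∀ᵐ y, ‖f y‖ₑ ≤ C * decayWeight (finrank ℝ E - 1) y := by
  have hn : (1 : ℝ) ≤ finrank ℝ E := Nat.one_le_cast.2 Module.finrank_pos
  have hn3 : (finrank ℝ E : ℝ) ≤ 3 := by exact_mod_cast hE
  refine exists_ae_le_decayWeight_of_le_lintegral_rieszKernel (ρ := ρ)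
    (c := ‖(sphereArea E)⁻¹‖₊ * K) (by linarith) (by linarith) (by linarith) hf.1.enorm
    (lintegral_enorm_sq_lt_top hf) ?_
  filter_upwards [h.ae_sphereArea_smul_eq_greenPotential_of_finrank_le_three hc hE hρ hf hF hK]
    with x hx
  rw [eq_inv_smul_iff₀ sphereArea_pos.ne' |>.2 hx, enorm_smul, ENNReal.coe_mul, mul_assoc,
    enorm_eq_nnnorm (sphereArea E)⁻¹]
  gcongr
  calc ‖greenPotential c F x‖ₑ ≤ ∫⁻ y, rieszKernel (finrank ℝ E - 1) x y * ‖F y‖ₑ :=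
        (enorm_integral_le_lintegral_enorm _).trans
          (lintegral_mono fun y => enorm_greenKernel_le hc x y (F y))
    _ ≤ _ := lintegral_rieszKernel_mul_enorm_le hK x

lemma exists_ae_enorm_rhs_le_decayWeight (h : IsWeakDiracSolution c f F) (hc : IsCliffordMul c)
    (hE : finrank ℝ E ≤ 3) (hρ : 1 < ρ) (hf : MemLp f 2) (hF : AEStronglyMeasurable F)
    (hK : ∀ᵐ y, ‖F y‖ₑ ≤ K * (decayWeight ρ y * ‖f y‖ₑ)) :
    ∃ C : ℝ≥0, ∀ᵐ y, ‖F y‖ₑ ≤ C * decayWeight (ρ + (finrank ℝ E - 1)) y := by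
  obtain ⟨C, hC⟩ := h.exists_ae_enorm_le_decayWeight hc hE hρ hf hF hK
  refine ⟨K * C, ?_⟩
  filter_upwards [hK, hC] with y hy hCy
  calc ‖F y‖ₑ ≤ K * (decayWeight ρ y * (C * decayWeight (finrank ℝ E - 1) y)) :=
        hy.trans (by gcongr)
    _ = (K * C : ℝ≥0) * decayWeight (ρ + (finrank ℝ E - 1)) y := by
        rw [← decayWeight_mul_decayWeight, ENNReal.coe_mul]
        ring

theorem exists_continuous_tendsto_rpow_smul (h : IsWeakDiracSolution c f F)
    (hc : IsCliffordMul c) (hE : finrank ℝ E ≤ 3) (hρ : 1 < ρ) (hf : MemLp f 2)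
    (hF : AEStronglyMeasurable F) (hK : ∀ᵐ y, ‖F y‖ₑ ≤ K * (decayWeight ρ y * ‖f y‖ₑ)) :
    Integrable F ∧ ∃ g : E → S, Continuous g ∧ f =ᵐ[volume] g ∧ ∀ ω : E, ‖ω‖ = 1 →
      Tendsto (fun r : ℝ => r ^ (finrank ℝ E - 1 : ℝ) • g (r • ω)) atTop
        (𝓝 ((sphereArea E)⁻¹ • c ω (∫ y, F y))) := by
  obtain ⟨C, hC⟩ := h.exists_ae_enorm_rhs_le_decayWeight hc hE hρ hf hF hK
  have hb : (finrank ℝ E : ℝ) < ρ + (finrank ℝ E - 1) := by linarith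
  refine ⟨integrable_of_enorm_le_decayWeight hF hb hC,
    fun x => (sphereArea E)⁻¹ • greenPotential c F x,
    (continuous_greenPotential hc hF hb hC).const_smul _, ?_, fun ω hω => ?_⟩
  · filter_upwards [h.ae_sphereArea_smul_eq_greenPotential_of_finrank_le_three hc hE hρ hf hF hK]
      with x hx using (eq_inv_smul_iff₀ sphereArea_pos.ne').2 hx
  · simpa only [smul_comm (sphereArea E)⁻¹] using
      (tendsto_rpow_smul_greenPotential hc hF hb hC hω).const_smul (sphereArea E)⁻¹

end IsWeakDiracSolution

end DecayingSolutions

section DiracOperator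

open scoped ContDiff
open Matrix (toEuclideanLin)

/-- The Clifford multiplication `(1 / i) α · v` by the Dirac matrices. -/
noncomputable def diracMul : R3 →L[ℝ] Spinor →L[ℝ] Spinor :=
  ∑ j, (EuclideanSpace.proj j : R3 →L[ℝ] ℝ).smulRight
    ((LinearMap.toContinuousLinearMap (Complex.I⁻¹ • toEuclideanLin (alpha j))).restrictScalars ℝ)

lemma diracMul_apply (v : R3) (s : Spinor) :
    diracMul v s = ∑ j, v j • toEuclideanLin (alpha j) (Complex.I⁻¹ • s) := by
  simp [diracMul]

lemma diracMul_apply_coord (v : R3) (s : Spinor) :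
    diracMul v s = -Complex.I • !₂[v 2 * s 2 + (v 0 - v 1 * Complex.I) * s 3,
      (v 0 + v 1 * Complex.I) * s 2 - v 2 * s 3, v 2 * s 0 + (v 0 - v 1 * Complex.I) * s 1,
      (v 0 + v 1 * Complex.I) * s 0 - v 2 * s 1] := by
  have hentry (j : Fin 3) (k l : Fin 4) : alpha j k l =
      Matrix.fromBlocks 0 (pauli j) (pauli j) 0 (finSumFinEquiv.symm k)
        (finSumFinEquiv.symm l) := rfl
  have h0 : (finSumFinEquiv.symm (0 : Fin 4) : Fin 2 ⊕ Fin 2) = Sum.inl 0 := rfl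
  have h1 : (finSumFinEquiv.symm (1 : Fin 4) : Fin 2 ⊕ Fin 2) = Sum.inl 1 := rfl
  have h2 : (finSumFinEquiv.symm (2 : Fin 4) : Fin 2 ⊕ Fin 2) = Sum.inr 0 := rfl
  have h3 : (finSumFinEquiv.symm (3 : Fin 4) : Fin 2 ⊕ Fin 2) = Sum.inr 1 := rfl
  rw [diracMul_apply]
  ext l
  fin_cases l <;>
  · simp [Fin.sum_univ_three, Matrix.toLpLin_apply, Matrix.mulVec, dotProduct, Fin.sum_univ_four,
      hentry, h0, h1, h2, h3, pauli]
    ring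

lemma isCliffordMul_diracMul : IsCliffordMul diracMul where
  apply_apply v s := by
    rw [EuclideanSpace.real_norm_sq_eq, diracMul_apply_coord, diracMul_apply_coord]
    ext l
    fin_cases l <;>
    · simp only [Fin.isValue, Fin.zero_eta, Fin.mk_one, Fin.reduceFinMk, neg_smul, PiLp.neg_apply,
        PiLp.smul_apply, Matrix.cons_val, Matrix.cons_val_zero, Matrix.cons_val_one, smul_eq_mul,
        mul_neg, sub_neg_eq_add, Fin.sum_univ_three, Complex.real_smul, Complex.ofReal_add,
        Complex.ofReal_pow, neg_inj]
      ring_nf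
      simp only [Complex.I_sq, Complex.I_pow_four]
      ring
  norm_apply v s := by
    rw [← sq_eq_sq₀ (norm_nonneg _) (by positivity), mul_pow, EuclideanSpace.norm_sq_eq,
      EuclideanSpace.norm_sq_eq, EuclideanSpace.norm_sq_eq, diracMul_apply_coord]
    simp [Fin.sum_univ_three, Fin.sum_univ_four, Complex.sq_norm, Complex.normSq_apply]
    ring

lemma diracMul_single (j : Fin 3) (s : Spinor) :
    diracMul (EuclideanSpace.single j 1) s = toEuclideanLin (alpha j) (Complex.I⁻¹ • s) := by
  rw [diracMul_apply]
  simp [ite_smul]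

lemma gradient_apply_eq_fderiv_single (φ : R3 → ℝ) (y : R3) (j : Fin 3) :
    ∇ φ y j = fderiv ℝ φ y (EuclideanSpace.single j 1) := by
  rw [← inner_gradient_left, EuclideanSpace.inner_single_right]
  simp

lemma volume_real_unitBall_R3 : volume.real (Metric.ball (0 : R3) 1) = 4 / 3 * Real.pi := by
  rw [measureReal_def, EuclideanSpace.volume_ball_fin_three, ENNReal.ofReal_one, one_pow, one_mul,
    ENNReal.toReal_ofReal (by positivity)]
  ring

lemma sphereArea_R3 : sphereArea R3 = 4 * Real.pi := by
  rw [sphereArea, finrank_euclideanSpace_fin, volume_real_unitBall_R3]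
  ring

lemma toEuclideanLin_apply_eq_sum {ι κ : Type*} [Fintype ι] [DecidableEq ι] [Fintype κ]
    [DecidableEq κ] (A : Matrix ι κ ℂ) (s : EuclideanSpace ℂ κ) :
    toEuclideanLin A s = ∑ j, ∑ k, (A j k * s k) • EuclideanSpace.single j (1 : ℂ) := by
  ext i
  simp [Matrix.toLpLin_apply, Matrix.mulVec, dotProduct, ← Finset.sum_smul, Pi.single_apply]

lemma norm_toEuclideanLin_le {ι κ : Type*} [Fintype ι] [Fintype κ] [DecidableEq κ]
    {A : Matrix ι κ ℂ} {B : ℝ} (hA : ∀ j k, ‖A j k‖ ≤ B) (s : EuclideanSpace ℂ κ) :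
    ‖toEuclideanLin A s‖ ≤ Fintype.card ι * Fintype.card κ * (B * ‖s‖) := by
  classical
  calc ‖toEuclideanLin A s‖ ≤ ∑ _j : ι, ∑ _k : κ, B * ‖s‖ := by
        rw [toEuclideanLin_apply_eq_sum]
        refine norm_sum_le_of_le _ fun j _ => norm_sum_le_of_le _ fun k _ => ?_
        rw [norm_smul, norm_mul, PiLp.norm_single, norm_one, mul_one]
        exact mul_le_mul (hA j k) (PiLp.norm_apply_le s k) (norm_nonneg _)
          ((norm_nonneg _).trans (hA j k))
    _ = Fintype.card ι * Fintype.card κ * (B * ‖s‖) := by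
        simp only [Finset.sum_const, Finset.card_univ, nsmul_eq_mul, mul_assoc]

variable {Q : R3 → Matrix (Fin 4) (Fin 4) ℂ} {f : R3 → Spinor}

lemma aestronglyMeasurable_potentialMul (hQ : ∀ j k, AEMeasurable (fun x => Q x j k) volume)
    (hf : AEStronglyMeasurable f) : AEStronglyMeasurable (potentialMul Q f) := by
  have hcoord (k : Fin 4) : AEStronglyMeasurable fun y => f y k :=
    (EuclideanSpace.proj k : Spinor →L[ℂ] ℂ).continuous.comp_aestronglyMeasurable hf
  unfold potentialMul
  simp only [toEuclideanLin_apply_eq_sum]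
  exact Finset.aestronglyMeasurable_fun_sum _ fun j _ =>
    Finset.aestronglyMeasurable_fun_sum _ fun k _ =>
      ((hQ j k).aestronglyMeasurable.mul (hcoord k)).smul_const _

lemma sqrt_one_add_norm_sq_rpow_neg_le {E : Type*} [NormedAddCommGroup E] {ρ : ℝ} (hρ : 0 ≤ ρ)
    (y : E) : √(1 + ‖y‖ ^ 2) ^ (-ρ) ≤ √2 ^ ρ * (1 + ‖y‖) ^ (-ρ) := by
  have hle : (1 + ‖y‖) / √2 ≤ √(1 + ‖y‖ ^ 2) := by
    rw [div_le_iff₀' (by positivity)]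
    exact one_add_norm_le_sqrt_two_mul_sqrt y
  refine (Real.rpow_le_rpow_of_nonpos (by positivity) hle (by linarith)).trans_eq ?_
  rw [Real.div_rpow (by positivity) (by positivity), Real.rpow_neg (x := √2) (by positivity),
    div_inv_eq_mul, mul_comm]

lemma IsAdmissiblePotential.exists_norm_potentialMul_le (hQ : IsAdmissiblePotential Q) :
    ∃ ρ C : ℝ, 1 < ρ ∧ ∀ (f : R3 → Spinor) (y : R3),
      ‖potentialMul Q f y‖ ≤ C * (1 + ‖y‖) ^ (-ρ) * ‖f y‖ := by
  obtain ⟨ρ, C, hρ, hC, hQ⟩ := hQ.decay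
  refine ⟨ρ, 16 * C * √2 ^ ρ, hρ, fun f y => ?_⟩
  have hentry (j k : Fin 4) : ‖Q y j k‖ ≤ C * (√2 ^ ρ * (1 + ‖y‖) ^ (-ρ)) :=
    (hQ y j k).trans (by gcongr; exact sqrt_one_add_norm_sq_rpow_neg_le (by linarith) y)
  refine (norm_toEuclideanLin_le hentry (f y)).trans_eq ?_
  simp only [Fintype.card_fin]
  ring

lemma IsZeroMode.memLp (hf : IsZeroMode Q f) : MemLp f 2 :=
  let ⟨_, hdf, _⟩ := hf
  hdf.memLp

lemma IsZeroMode.isWeakDiracSolution (hf : IsZeroMode Q f) :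
    IsWeakDiracSolution diracMul f (potentialMul Q f) := by
  obtain ⟨df, hdf, hzero⟩ := hf
  intro φ hφ hφc
  have hgrad (j : Fin 3) : Integrable fun y => fderiv ℝ φ y (EuclideanSpace.single j 1) • f y := by
    refine (hdf.memLp.locallyIntegrable one_le_two).integrable_smul_left_of_hasCompactSupport
      ?_ (hφc.fderiv_apply ℝ _)
    exact (hφ.continuous_fderiv (by simp)).clm_apply continuous_const
  have hφdf (j : Fin 3) : Integrable fun y => φ y • df j y :=
    ((hdf.memLp_grad j).locallyIntegrable one_le_two).integrable_smul_left_of_hasCompactSupport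
      hφ.continuous hφc
  calc ∫ y, diracMul (∇ φ y) (f y)
      = ∫ y, ∑ j, diracMul (EuclideanSpace.single j 1)
          (fderiv ℝ φ y (EuclideanSpace.single j 1) • f y) := by
        congr 1 with y : 1
        simp only [diracMul_apply (∇ φ y), diracMul_single, gradient_apply_eq_fderiv_single,
          map_smul]
    _ = ∑ j, diracMul (EuclideanSpace.single j 1)
          (∫ y, fderiv ℝ φ y (EuclideanSpace.single j 1) • f y) := by
        rw [integral_finsetSum _ fun j _ => (diracMul _).integrable_comp (hgrad j)]
        exact Finset.sum_congr rfl fun j _ => (diracMul _).integral_comp_comm (hgrad j)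
    _ = -∑ j, ∫ y, diracMul (EuclideanSpace.single j 1) (φ y • df j y) := by
        rw [← Finset.sum_neg_distrib]
        refine Finset.sum_congr rfl fun j _ => ?_
        rw [hdf.weakDeriv j φ hφ hφc, map_neg, (diracMul _).integral_comp_comm (hφdf j)]
    _ = ∫ y, φ y • potentialMul Q f y := by
        rw [← integral_finsetSum _ fun j _ => (diracMul _).integrable_comp (hφdf j),
          ← integral_neg]
        refine integral_congr_ae ?_
        filter_upwards [hzero] with y hy
        rw [diracExpr, Pi.zero_apply, add_comm, add_eq_zero_iff_eq_neg] at hy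
        simp only [map_smul, diracMul_single, potentialMul, hy, smul_neg, Finset.smul_sum]

end DiracOperator

end DiracZeroMode

theorem mainTheorem2_general {E S : Type*} [NormedAddCommGroup E] [InnerProductSpace ℝ E]
    [FiniteDimensional ℝ E] [Nontrivial E] [MeasurableSpace E] [BorelSpace E]
    [NormedAddCommGroup S] [NormedSpace ℝ S] [CompleteSpace S] (hE : Module.finrank ℝ E ≤ 3)
    {c : E →L[ℝ] S →L[ℝ] S} (hc : DiracZeroMode.IsCliffordMul c) {f F : E → S} (hf : MemLp f 2)
    (hF : AEStronglyMeasurable F) {ρ C : ℝ} (hρ : 1 < ρ)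
    (hC : ∀ᵐ y, ‖F y‖ ≤ C * (1 + ‖y‖) ^ (-ρ) * ‖f y‖)
    (h : DiracZeroMode.IsWeakDiracSolution c f F) :
    Integrable F ∧ ∃ g : E → S, Continuous g ∧ f =ᵐ[volume] g ∧
      (∀ ω ∈ Metric.sphere (0 : E) 1,
        Tendsto (fun r : ℝ => r ^ (Module.finrank ℝ E - 1 : ℝ) * ‖g (r • ω)‖) atTop
          (𝓝 (1 / DiracZeroMode.sphereArea E * ‖∫ y, F y‖))) ∧
      ((∃ ω ∈ Metric.sphere (0 : E) 1,
          Tendsto (fun r : ℝ => r ^ (Module.finrank ℝ E - 1 : ℝ) • g (r • ω)) atTop (𝓝 0)) ↔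
        ∫ y, F y = 0) ∧
      ((∀ ω ∈ Metric.sphere (0 : E) 1,
          Tendsto (fun r : ℝ => r ^ (Module.finrank ℝ E - 1 : ℝ) • g (r • ω)) atTop (𝓝 0)) ↔
        ∫ y, F y = 0) := by
  obtain ⟨hFint, g, hg, hfg, hlim⟩ := h.exists_continuous_tendsto_rpow_smul hc hE hρ hf hF
    (hC.mono fun _ => DiracZeroMode.enorm_le_mul_decayWeight_mul_enorm)
  simp only [← mem_sphere_zero_iff_norm] at hlim
  have hσ := DiracZeroMode.sphereArea_pos (E := E)
  have hnorm (ω) (hω : ω ∈ Metric.sphere (0 : E) 1) :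
      ‖(DiracZeroMode.sphereArea E)⁻¹ • c ω (∫ y, F y)‖ =
        1 / DiracZeroMode.sphereArea E * ‖∫ y, F y‖ := by
    rw [norm_smul, hc.norm_apply, mem_sphere_zero_iff_norm.1 hω, one_mul,
      Real.norm_of_nonneg (inv_nonneg.2 hσ.le), one_div]
  have hzero (ω) (hω : ω ∈ Metric.sphere (0 : E) 1) :
      Tendsto (fun r : ℝ => r ^ (Module.finrank ℝ E - 1 : ℝ) • g (r • ω)) atTop (𝓝 0) ↔
        ∫ y, F y = 0 := by
    have heq : (DiracZeroMode.sphereArea E)⁻¹ • c ω (∫ y, F y) = 0 ↔ ∫ y, F y = 0 := by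
      rw [← norm_eq_zero, hnorm ω hω]
      simp [hσ.ne']
    exact ⟨fun h0 => heq.1 (tendsto_nhds_unique (hlim ω hω) h0), fun h0 => heq.2 h0 ▸ hlim ω hω⟩
  obtain ⟨ω₀, hω₀⟩ : (Metric.sphere (0 : E) 1).Nonempty :=
    NormedSpace.sphere_nonempty.2 zero_le_one
  refine ⟨hFint, g, hg, hfg, fun ω hω => ?_,
    ⟨fun ⟨ω, hω, h0⟩ => (hzero ω hω).1 h0, fun h0 => ⟨ω₀, hω₀, (hzero ω₀ hω₀).2 h0⟩⟩,
    ⟨fun h0 => (hzero ω₀ hω₀).1 (h0 ω₀ hω₀), fun h0 ω hω => (hzero ω hω).2 h0⟩⟩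
  rw [← hnorm ω hω]
  refine (hlim ω hω).norm.congr' ?_
  filter_upwards [eventually_ge_atTop 0] with r hr
  rw [norm_smul, Real.norm_of_nonneg (by positivity)]

theorem mainTheorem2
    (Q : DiracZeroMode.R3 → Matrix (Fin 4) (Fin 4) ℂ)
    (hQ : DiracZeroMode.IsAdmissiblePotential Q)
    (f : DiracZeroMode.R3 → DiracZeroMode.Spinor)
    (hf : DiracZeroMode.IsZeroMode Q f) :
    Integrable (DiracZeroMode.potentialMul Q f) volume ∧
    -- `g` is the continuous representative of the zero mode; it is unique
    ∃ g : DiracZeroMode.R3 → DiracZeroMode.Spinor, Continuous g ∧ f =ᵐ[volume] g ∧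
      (∀ ω ∈ Metric.sphere (0 : DiracZeroMode.R3) 1,
        Tendsto (fun r : ℝ => r ^ 2 * ‖g (r • ω)‖) atTop
          (𝓝 (1 / (4 * Real.pi) * ‖∫ y, DiracZeroMode.potentialMul Q f y‖))) ∧
      ((∃ ω ∈ Metric.sphere (0 : DiracZeroMode.R3) 1,
          Tendsto (fun r : ℝ => r ^ 2 • g (r • ω)) atTop (𝓝 0)) ↔
        ∫ y, DiracZeroMode.potentialMul Q f y = 0) ∧
      ((∀ ω ∈ Metric.sphere (0 : DiracZeroMode.R3) 1,
          Tendsto (fun r : ℝ => r ^ 2 • g (r • ω)) atTop (𝓝 0)) ↔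
        ∫ y, DiracZeroMode.potentialMul Q f y = 0) := by
  obtain ⟨ρ, C, hρ, hC⟩ := hQ.exists_norm_potentialMul_le
  have hpow (r : ℝ) : r ^ ((3 : ℕ) - 1 : ℝ) = r ^ 2 := by norm_num
  simpa only [finrank_euclideanSpace_fin, DiracZeroMode.sphereArea_R3, hpow] using
    mainTheorem2_general (by simp) DiracZeroMode.isCliffordMul_diracMul hf.memLp
      (DiracZeroMode.aestronglyMeasurable_potentialMul hQ.aemeasurable hf.memLp.1) hρ
      (ae_of_all _ (hC f)) hf.isWeakDiracSolution
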